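/- **Setting.** Let $V$ be a finite-dimensional real inner product space with inner product $(\cdot,\cdot)$, of dimension $n$, with its Lebesgue measure. Let $E\subset V$ be a finite set of unit vectors, no two of which are linearly dependent. For $e\in E$ put $H_e=\{x\in V:(e,x)=0\}$, and let $\mathcal H=\{H_e:e\in E\}$. The *chambers* of an arrangement are the connected components of the complement of the union of its hyperplanes. We assume that $\mathcal H$ has a chamber $T_0$ (the *base chamber*) with $(e,x)>0$ for all $e\in E$, $x\in T_0$. For an arrangement with a chosen base chamber, the sign of a chamber $T$ is $(-1)^T=(-1)^{s}$, where $s$ is the number of hyperplanes separating $T$ from the base chamber. The *pizza quantity* of a function $g$ is $$P(\mathcal H,g)=\sum_{T}(-1)^T\int_T g ,$$ where the sum is over all chambers $T$; it depends on the base chamber. For $g:V\to\mathbb C$ and $a\in V$ put $g_a(x)=g(x-a)$. A *face* of $\mathcal H$ is a non-empty set consisting of all $x\in V$ for which $(e,x)$ has a prescribed sign in $\{+,-,0\}$ for each $e\in E$. A *facet* of a chamber $T$ is a face of dimension $n-1$ contained in $\overline T$. For a face $F$ and $v\in V$, $F\circ v$ denotes the face that contains $x+\varepsilon v$ for every $x\in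 F$ and all sufficiently small $\varepsilon>0$. For $e\in E$, the *restricted arrangement* $\mathcal H''_e=\{H_e\cap H_f: f\in E,\ f\ne e\}$ and the *even restricted arrangement* $$\mathcal H_e=\bigl\{H_e\cap H_f: f\in E,\ f\neq e,\ |\{g\in E: H_g\supseteq H_e\cap H_f\}|\ \text{is even}\bigr\}$$ are arrangements in the inner product space $H_e$. For a chamber $Z$ of $\mathcal H_e$ put $(-1)^{Z\circ e}=(-1)^{U\circ e}$, where $U$ is any chamber of $\mathcal H''_e$ contained in $Z$. **Theorem.** Let $f:V\to\mathbb C$ be an $L^1$ function and let $a\in V$. For every $e\in E$ with $(a,e)\neq 0$ the function $(t,y)\mapsto f_{ta}(y)$ is integrable on $[0,1]\times H_e$. In the formulas below, a term with $(a,e_U)=0$, respectively $(a,e)=0$, is read as $0$. Moreover: (i) Let $T$ be a chamber of $\mathcal H$. Every facet $U$ of $T$ is contained in $H_{e_U}$ for a unique $e_U\in E$, and $$\int_T f_a\,dV-\int_T f\,dV=\sum_{U}(-1)^T(-1)^{U\circ e_U}\,(a,e_U)\int_0^1\Bigl(\int_U f_{ta}(y)\,dV_{H_{e_U}}\Bigr)dt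 ,$$ where the sum is over all facets $U$ of $T$ and $dV_{H_{e_U}}$ is Lebesgue measure on $H_{e_U}$. (ii) For every $e\in E$ the sign $(-1)^{Z\circ e}$ is well defined: each chamber $Z$ of $\mathcal H_e$ contains a chamber $U$ of $\mathcal H''_e$, and $(-1)^{U\circ e}$ is the same for all such $U$. For each $e\in E$ let $Z_0(e)$ be an arbitrarily chosen base chamber of $\mathcal H_e$. Then $$P(\mathcal H,f_a)-P(\mathcal H,f)=2\sum_{e\in E}(-1)^{Z_0(e)\circ e}\,(a,e)\int_0^1P\bigl(\mathcal H_e,\,f_{ta}|_{H_e}\bigr)\,dt .$$ -/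

import Mathlib

open MeasureTheory Filter Topology

namespace Pizza

noncomputable section

/-- Lebesgue measure of a finite-dimensional real inner product space, transported from `ℝⁿ` by an
isometry. It is named here so that, on a subspace, it is never confused with the restriction of the
measure of the ambient space. -/
def vol (V : Type*) [NormedAddCommGroup V] [InnerProductSpace ℝ V] [FiniteDimensional ℝ V]
    [MeasurableSpace V] [BorelSpace V] : Measure V :=
  @volume V measureSpaceOfInnerProductSpace

section Arrangements

variable {V : Type*} [NormedAddCommGroup V] [InnerProductSpace ℝ V]

/-- The chambers of the arrangement `A`: the connected components of the complement. -/
def chambers (A : Set (Submodule ℝ V)) : Set (Set V) :=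
  {T | ∃ x ∈ (⋃ H ∈ A, (H : Set V))ᶜ, T = connectedComponentIn (⋃ H ∈ A, (H : Set V))ᶜ x}

/-- The hyperplane `H` separates `S` and `T`: they lie in the two different open half-spaces
bounded by `H`. -/
def Separates (H : Submodule ℝ V) (S T : Set V) : Prop :=
  ∃ v : V, H = (Submodule.span ℝ {v})ᗮ ∧
    (∀ x ∈ S, 0 < inner ℝ v x) ∧ (∀ y ∈ T, inner ℝ v y < 0)

/-- The set of hyperplanes of `A` that separate `S` and `T`. -/
def separationSet (A : Set (Submodule ℝ V)) (S T : Set V) : Set (Submodule ℝ V) :=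
  {H | H ∈ A ∧ Separates H S T}

/-- The sign `(-1)^T` of the chamber `T`, relative to the base chamber `T₀`. -/
def chamberSign (A : Set (Submodule ℝ V)) (T₀ T : Set V) : ℤ :=
  (-1) ^ (separationSet A T₀ T).ncard

/-- The translate `f_a : x ↦ f (x - a)`. -/
def shift (a : V) (f : V → ℂ) : V → ℂ := fun x => f (x - a)

/-- The pizza quantity `P(A, f)` relative to the base chamber `T₀`. -/
def pizza [FiniteDimensional ℝ V] [MeasurableSpace V] [BorelSpace V]
    (A : Set (Submodule ℝ V)) (T₀ : Set V) (f : V → ℂ) : ℂ :=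
  ∑ᶠ T ∈ chambers A, (chamberSign A T₀ T : ℂ) * ∫ x in T, f x ∂(vol V)

/-- The hyperplane `H_e`, the orthogonal complement of the vector `e`. -/
def hyp (e : V) : Submodule ℝ V := (Submodule.span ℝ {e})ᗮ

/-- The arrangement `{H_e : e ∈ E}`. -/
def arr (E : Finset V) : Set (Submodule ℝ V) := {H | ∃ e ∈ E, H = hyp e}

/-- The intersection multiplicity `|{g ∈ E : W ⊆ H_g}|`. -/
def interMult (E : Finset V) (W : Submodule ℝ V) : ℕ := {g : V | g ∈ E ∧ W ≤ hyp g}.ncard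

/-- The restricted arrangement `{H_e ∩ H_f : f ∈ E, f ≠ e}`, inside the space `H_e`. -/
def restrictedArr (E : Finset V) (e : V) : Set (Submodule ℝ (hyp e)) :=
  {W | ∃ f ∈ E, f ≠ e ∧ W = (hyp f).comap (hyp e).subtype}

/-- The even restricted arrangement: those `H_e ∩ H_f` with even intersection multiplicity,
inside the space `H_e`. -/
def evenArr (E : Finset V) (e : V) : Set (Submodule ℝ (hyp e)) :=
  {W | ∃ f ∈ E, f ≠ e ∧ Even (interMult E (hyp e ⊓ hyp f)) ∧ W = (hyp f).comap (hyp e).subtype}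

/-- An (open) face: a non-empty set cut out by prescribing, for each `e ∈ E`, whether the point
lies on `H_e` or in which of the two open half-spaces. -/
def IsFace (E : Finset V) (F : Set V) : Prop :=
  F.Nonempty ∧ ∃ σ : V → SignType, F = {x | ∀ e ∈ E, SignType.sign (inner ℝ e x : ℝ) = σ e}

/-- The facets of `T`: the faces of codimension one contained in the closure of `T`. -/
def facets (E : Finset V) (T : Set V) : Set (Set V) :=
  {U | IsFace E U ∧
    Module.finrank ℝ (Submodule.span ℝ U) + 1 = Module.finrank ℝ V ∧ U ⊆ closure T}

/-- The composition `F ∘ v`: the face that contains `x + ε v` for all `x ∈ F` and all small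
`ε > 0`, given as the set of all points `y` with the same sign vector as these `x + ε v`. -/
def faceComp (E : Finset V) (F : Set V) (v : V) : Set V :=
  {y | ∀ x ∈ F, ∀ᶠ ε in 𝓝[>] (0 : ℝ), ∀ e ∈ E,
    SignType.sign (inner ℝ e y : ℝ) = SignType.sign (inner ℝ e (x + ε • v) : ℝ)}

/-- The sign `(-1)^{F ∘ v}`. -/
def compSign (E : Finset V) (T₀ F : Set V) (v : V) : ℤ :=
  chamberSign (arr E) T₀ (faceComp E F v)

end Arrangements

end

end Pizza

/-! Both formulas are cases of one identity. A signed sum of chamber integrals is `∫ Φ(signVec x)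
f(x)` for a function `Φ` of the sign vector. Moving the translation from `f` onto `Φ`, the change is
the integral of `(Φ(signVec (x+a)) - Φ(signVec x)) f(x)`. For almost every `x` the segment from `x`
to `x+a` crosses the hyperplanes one at a time, so the bracket telescopes into jumps of `Φ` at the
crossing points (`jump_sum`). Writing `x = y - t a` with `y ∈ H_e`, `t ∈ [0,1]`, whose Jacobian is
`|(a,e)|`, turns each jump term into an integral over `[0,1] × H_e` (`integral_swept`), and the
direction of crossing restores the sign of `(a,e)`. The result is `integral_shift_sub`; `f` need
only be `L¹`.

For (i), `Φ` is the indicator of the sign vector of `T`; its jump across `H_e` is, up to sign, the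
indicator of the facet of `T` in `H_e`. For (ii), `Φ` is the product of all signs; its jump is twice
the product over `g ≠ e`. On `H_e` the vectors `g` cutting out the same subspace change sign
together, so only classes of odd size matter. Counting `e` as well, these are the intersections of
even multiplicity: the product is, up to a constant sign, the chamber sign of the even restricted
arrangement (`chamberSign_evenArr`). -/

namespace Pizza

/-! ### Lebesgue measure in the coordinates given by `H_e` and a transversal direction. -/

section Measure

variable {V : Type*} [NormedAddCommGroup V] [InnerProductSpace ℝ V]

theorem mem_hyp {e x : V} : x ∈ hyp e ↔ inner ℝ e x = 0 :=
  Submodule.mem_orthogonal_singleton_iff_inner_right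

/-- The isometry `ℝ × H_e → V` sending `(s, y)` to `s e + y`, for a unit vector `e`. -/
noncomputable def hypProdIsometry {e : V} (he : ‖e‖ = 1) :
    WithLp 2 (ℝ × hyp e) →ₗᵢ[ℝ] V where
  toFun p := p.fst • e + (p.snd : V)
  map_add' p q := by simp [add_smul]; abel
  map_smul' c p := by simp [mul_smul]
  norm_map' p := by
    have h : inner ℝ (p.fst • e) (p.snd : V) = 0 := by
      rw [inner_smul_left, mem_hyp.1 p.snd.2, mul_zero]
    have h1 := norm_add_sq_eq_norm_sq_add_norm_sq_real h
    have h2 := WithLp.prod_norm_sq_eq_of_L2 p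
    rw [norm_smul, he, mul_one] at h1
    have h3 : ‖p.fst • e + (p.snd : V)‖ ^ 2 = ‖p‖ ^ 2 := by
      rw [h2, sq, h1, sq, sq]; rfl
    exact (sq_eq_sq₀ (norm_nonneg _) (norm_nonneg _)).1 h3

theorem hypProdIsometry_surjective {e : V} (he : ‖e‖ = 1) :
    Function.Surjective (hypProdIsometry he) := by
  intro x
  have hx : x - (inner ℝ e x : ℝ) • e ∈ hyp e := by
    rw [mem_hyp, inner_sub_right, inner_smul_right, real_inner_self_eq_norm_sq, he]; simp
  exact ⟨WithLp.toLp 2 (inner ℝ e x, ⟨_, hx⟩), by simp [hypProdIsometry]⟩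

variable [FiniteDimensional ℝ V] [MeasurableSpace V] [BorelSpace V]

instance : (vol V).IsAddHaarMeasure :=
  let _ := @measureSpaceOfInnerProductSpace V _ _ _ _ _
  inferInstanceAs (volume : Measure V).IsAddHaarMeasure

theorem measurePreserving_hypProd {e : V} (he : ‖e‖ = 1) :
    MeasurePreserving (fun p : ℝ × hyp e => p.1 • e + (p.2 : V))
      ((volume : Measure ℝ).prod (vol (hyp e))) (vol V) := by
  let _ := @measureSpaceOfInnerProductSpace V _ _ _ _ _
  let _ := @measureSpaceOfInnerProductSpace (hyp e) _ _ _ _ _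
  have h := (LinearIsometryEquiv.ofSurjective (hypProdIsometry he)
    (hypProdIsometry_surjective he)).measurePreserving.comp
      (WithLp.volume_preserving_toLp ℝ (hyp e))
  exact h

/-- With `c = (a,e)`, `y - t a = (-c t) e + (y - t (a - c e))`: a shear along `H_e`, then scaling of
`t` by `-c`, then an isometry. Only the scaling changes the measure. -/
theorem map_translate {e a : V} (he : ‖e‖ = 1) (ha : (inner ℝ a e : ℝ) ≠ 0) :
    Measure.map (fun p : ℝ × hyp e => (p.2 : V) - p.1 • a)
      ((volume : Measure ℝ).prod (vol (hyp e))) =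
      ENNReal.ofReal |(inner ℝ a e : ℝ)|⁻¹ • vol V := by
  set c : ℝ := inner ℝ a e with hc
  have hb : a - c • e ∈ hyp e := by
    rw [mem_hyp, inner_sub_right, inner_smul_right, real_inner_self_eq_norm_sq, he, hc,
      real_inner_comm]; simp
  have shear : MeasurePreserving
      (fun p : ℝ × hyp e => (p.1, p.2 - p.1 • (⟨_, hb⟩ : hyp e)))
      ((volume : Measure ℝ).prod (vol (hyp e))) ((volume : Measure ℝ).prod (vol (hyp e))) := by
    refine (MeasurePreserving.id volume).skew_product (g := fun t y => y - t • (⟨_, hb⟩ : hyp e))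
      (by fun_prop) (ae_of_all _ fun t => ?_)
    exact (measurePreserving_sub_right (vol (hyp e)) _).map_eq
  have scale : Measure.map (Prod.map (fun t : ℝ => -c * t) (id : hyp e → hyp e))
      ((volume : Measure ℝ).prod (vol (hyp e))) =
      ENNReal.ofReal |c|⁻¹ • (volume : Measure ℝ).prod (vol (hyp e)) := by
    rw [← Measure.map_prod_map _ _ (by fun_prop) measurable_id, Measure.map_id,
      Real.map_volume_mul_left (neg_ne_zero.2 ha), Measure.prod_smul_left]
    simp
  have key : (fun p : ℝ × hyp e => (p.2 : V) - p.1 • a) =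
      (fun p : ℝ × hyp e => p.1 • e + (p.2 : V)) ∘
        Prod.map (fun t : ℝ => -c * t) (id : hyp e → hyp e) ∘
        (fun p : ℝ × hyp e => (p.1, p.2 - p.1 • (⟨_, hb⟩ : hyp e))) := by
    funext p
    simp only [Function.comp, Prod.map, id, Submodule.coe_sub, Submodule.coe_smul, smul_sub]
    rw [smul_smul, neg_mul, neg_smul, mul_comm c]
    abel
  rw [key, ← Measure.map_map (by fun_prop) (by fun_prop),
    ← Measure.map_map (by fun_prop) (by fun_prop), shear.map_eq, scale, Measure.map_smul,
    (measurePreserving_hypProd he).map_eq]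

theorem integrable_translate {e a : V} (he : ‖e‖ = 1) (ha : (inner ℝ a e : ℝ) ≠ 0)
    {g : V → ℂ} (hg : Integrable g (vol V)) :
    Integrable (fun p : ℝ × hyp e => g ((p.2 : V) - p.1 • a))
      ((volume : Measure ℝ).prod (vol (hyp e))) := by
  have h : Integrable g (Measure.map (fun p : ℝ × hyp e => (p.2 : V) - p.1 • a)
      ((volume : Measure ℝ).prod (vol (hyp e)))) := by
    rw [map_translate he ha]
    exact hg.smul_measure ENNReal.ofReal_ne_top
  exact h.comp_measurable (by fun_prop)

theorem integral_translate {e a : V} (he : ‖e‖ = 1) (ha : (inner ℝ a e : ℝ) ≠ 0)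
    {g : V → ℂ} (hg : Integrable g (vol V)) :
    |(inner ℝ a e : ℝ)| * ∫ p : ℝ × hyp e, g ((p.2 : V) - p.1 • a)
      ∂((volume : Measure ℝ).prod (vol (hyp e))) = ∫ x, g x ∂(vol V) := by
  have h : Integrable g (Measure.map (fun p : ℝ × hyp e => (p.2 : V) - p.1 • a)
      ((volume : Measure ℝ).prod (vol (hyp e)))) := by
    rw [map_translate he ha]
    exact hg.smul_measure ENNReal.ofReal_ne_top
  rw [← integral_map (f := g) (by fun_prop) h.aestronglyMeasurable, map_translate he ha,
    integral_smul_measure, ENNReal.toReal_ofReal (by positivity), Complex.real_smul,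
    ← mul_assoc, ← Complex.ofReal_mul, mul_inv_cancel₀ (abs_ne_zero.2 ha)]
  simp

theorem vol_hyp {w : V} (hw : w ≠ 0) : vol V (hyp w) = 0 := by
  refine Measure.addHaar_submodule _ _ fun h => hw ?_
  have : w ∈ hyp w := h ▸ Submodule.mem_top
  exact inner_self_eq_zero.1 (mem_hyp.1 this)

end Measure

/-! ### Telescoping a function of finitely many entries. -/

section Telescope

/-- Changing the entries of `σ` into those of `ρ` one at a time, in increasing order of `τ`. -/
theorem piecewise_sub_eq_sum {ι α R : Type*} [DecidableEq ι] [LinearOrder R]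
    (τ : ι → R) (σ ρ : ι → α) (Φ : (ι → α) → ℂ) (S : Finset ι) (hτ : Set.InjOn τ S) :
    Φ (S.piecewise ρ σ) - Φ σ = ∑ i ∈ S,
      (Φ (Function.update ({j ∈ S | τ j < τ i}.piecewise ρ σ) i (ρ i)) -
        Φ ({j ∈ S | τ j < τ i}.piecewise ρ σ)) := by
  induction S using Finset.induction_on_max_value τ with
  | empty => simp
  | insert i S hi hmax ih =>
    -- The new index is changed last: its set of earlier indices is all of `S`, and those of the
    -- other indices do not see it.
    have hlt : ∀ j ∈ S, τ j < τ i := fun j hj =>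
      lt_of_le_of_ne (hmax j hj) fun h => hi
        (hτ (Finset.mem_insert_of_mem hj) (Finset.mem_insert_self _ _) h ▸ hj)
    have h1 : {j ∈ insert i S | τ j < τ i} = S := by
      rw [Finset.filter_insert, if_neg (lt_irrefl _), Finset.filter_true_of_mem hlt]
    have h2 : ∀ k ∈ S, {j ∈ insert i S | τ j < τ k} = {j ∈ S | τ j < τ k} := by
      intro k hk
      rw [Finset.filter_insert, if_neg (not_lt.2 (hmax k hk))]
    rw [Finset.sum_insert hi, h1, Finset.sum_congr rfl fun k hk => by rw [h2 k hk],
      ← ih (hτ.mono (by simp)), Finset.piecewise_insert]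
    ring

end Telescope

/-! ### Sign vectors along a line. -/

section Crossing

variable {V : Type*} [NormedAddCommGroup V] [InnerProductSpace ℝ V]
variable {ι : Type*}

/-- The sign vector of `x` with respect to the normal vectors `v i`. -/
noncomputable def signVec (v : ι → V) (x : V) : ι → SignType :=
  fun i => SignType.sign (inner ℝ (v i) x : ℝ)

/-- The jump of `Φ ∘ signVec v` across the hyperplane normal to `v i`, at a point `y` of it. -/
noncomputable def jump [DecidableEq ι] (v : ι → V) (Φ : (ι → SignType) → ℂ) (i : ι) (y : V) : ℂ :=
  Φ (Function.update (signVec v y) i 1) - Φ (Function.update (signVec v y) i (-1))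

/-- The time at which the line `t ↦ x + t • a` crosses the hyperplane normal to `e`. -/
noncomputable def crossTime (a e x : V) : ℝ := -(inner ℝ e x) / inner ℝ a e

theorem inner_line {a e : V} (h : (inner ℝ a e : ℝ) ≠ 0) (x : V) (t : ℝ) :
    (inner ℝ e (x + t • a) : ℝ) = inner ℝ a e * (t - crossTime a e x) := by
  rw [inner_add_right, inner_smul_right, crossTime, real_inner_comm a e, mul_sub,
    mul_div_cancel₀ _ h]
  ring

theorem sign_line {a e : V} (h : (inner ℝ a e : ℝ) ≠ 0) (x : V) (t : ℝ) :
    SignType.sign (inner ℝ e (x + t • a) : ℝ) =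
      SignType.sign (inner ℝ a e : ℝ) * SignType.sign (t - crossTime a e x) := by
  rw [inner_line h, sign_mul]

/-- The segment from `x` to `x + a` starts and ends off the hyperplanes, and crosses them one at a
time. -/
def IsGeneric (v : ι → V) (a x : V) : Prop :=
  (∀ i, (inner ℝ (v i) x : ℝ) ≠ 0) ∧ (∀ i, (inner ℝ (v i) (x + a) : ℝ) ≠ 0) ∧
    ∀ i j, i ≠ j → (inner ℝ a (v i) : ℝ) ≠ 0 →
      (inner ℝ ((inner ℝ a (v j) : ℝ) • v i - (inner ℝ a (v i) : ℝ) • v j) x : ℝ) ≠ 0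

/-- Entry `i` flips from `-sign (a, v i)` to `sign (a, v i)` at its crossing time. Just before, the
entries crossed earlier have their final value and the others their initial one; apart from entry
`i`, this is the sign vector of the crossing point. -/
theorem jump_sum [Fintype ι] [DecidableEq ι] {v : ι → V} {a x : V} (hx : IsGeneric v a x)
    (Φ : (ι → SignType) → ℂ) :
    Φ (signVec v (x + a)) - Φ (signVec v x) =
      ∑ i, ((SignType.sign (inner ℝ a (v i) : ℝ) : ℝ) : ℂ) *
        (Set.indicator (Set.Icc 0 1) (fun t : ℝ => jump v Φ i (x + t • a))
          (crossTime a (v i) x)) := by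
  obtain ⟨h0, h1, h2⟩ := hx
  set τ : ι → ℝ := fun i => crossTime a (v i) x with hτ
  -- The hyperplanes that the segment really crosses. All others contribute `0`: parallel ones
  -- through the sign factor, the rest through the indicator.
  set S : Finset ι := {i | (inner ℝ a (v i) : ℝ) ≠ 0 ∧ τ i ∈ Set.Icc (0 : ℝ) 1} with hS
  have memS : ∀ i, i ∈ S ↔ (inner ℝ a (v i) : ℝ) ≠ 0 ∧ τ i ∈ Set.Icc (0 : ℝ) 1 := by simp [hS]
  have hline : ∀ i (t : ℝ), (inner ℝ a (v i) : ℝ) ≠ 0 → signVec v (x + t • a) i =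
      SignType.sign (inner ℝ a (v i) : ℝ) * SignType.sign (t - τ i) :=
    fun i t h => sign_line h x t
  have hpar : ∀ i (t : ℝ), (inner ℝ a (v i) : ℝ) = 0 → signVec v (x + t • a) i = signVec v x i := by
    intro i t h
    simp [signVec, inner_add_right, inner_smul_right, real_inner_comm a (v i), h]
  have e0 : signVec v x = signVec v (x + (0 : ℝ) • a) := by simp
  have e1 : signVec v (x + a) = signVec v (x + (1 : ℝ) • a) := by simp
  have hne : ∀ i ∈ S, 0 < τ i ∧ τ i < 1 := by
    intro i hi
    obtain ⟨ha, hl, hu⟩ := (memS i).1 hi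
    refine ⟨lt_of_le_of_ne hl fun h => h0 i ?_, lt_of_le_of_ne hu fun h => h1 i ?_⟩
    · have := inner_line ha x 0
      simpa [← h, hτ] using this.trans (by rw [show crossTime a (v i) x = 0 from h.symm]; simp)
    · have := inner_line ha x 1
      simpa using this.trans (by rw [show crossTime a (v i) x = 1 from h]; simp)
  -- Equal crossing times would put `x` on the hyperplane excluded by the last clause of
  -- `IsGeneric`.
  have hinj : ∀ i ∈ S, ∀ j, (inner ℝ a (v j) : ℝ) ≠ 0 → τ i = τ j → i = j := by
    intro i hi j hj h
    by_contra hij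
    have ha := ((memS i).1 hi).1
    refine h2 i j hij ha ?_
    simp only [hτ, crossTime] at h
    rw [div_eq_div_iff ha hj] at h
    rw [inner_sub_left, inner_smul_left, inner_smul_left]
    simp only [conj_trivial]
    linarith
  have hoff : ∀ i ∉ S, ∀ t ∈ Set.Icc (0 : ℝ) 1, signVec v (x + t • a) i = signVec v x i := by
    intro i hi t ht
    by_cases ha : (inner ℝ a (v i) : ℝ) = 0
    · exact hpar i t ha
    rw [e0, hline i t ha, hline i 0 ha]
    congr 1
    rw [memS, not_and] at hi
    have := hi ha
    rw [Set.mem_Icc, not_and_or, not_le, not_le] at this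
    rcases this with h | h
    · rw [sign_pos (by linarith [ht.1]), sign_pos (by linarith)]
    · rw [sign_neg (by linarith [ht.2]), sign_neg (by linarith)]
  have hend : S.piecewise (signVec v (x + a)) (signVec v x) = signVec v (x + a) := by
    ext1 i
    by_cases hi : i ∈ S
    · simp [hi]
    · rw [Finset.piecewise_eq_of_notMem _ _ _ hi, e1, hoff i hi 1 (by simp)]
  have hτinj : Set.InjOn τ S := fun i hi j hj h => hinj i hi j ((memS j).1 hj).1 h
  have hmain := piecewise_sub_eq_sum τ (signVec v x) (signVec v (x + a)) Φ S hτinj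
  rw [hend] at hmain
  rw [hmain]
  have hrest : ∀ i ∉ S, ((SignType.sign (inner ℝ a (v i) : ℝ) : ℝ) : ℂ) *
        (Set.indicator (Set.Icc 0 1) (fun t : ℝ => jump v Φ i (x + t • a))
          (crossTime a (v i) x)) = 0 := by
    intro i hi
    rw [memS, not_and] at hi
    by_cases ha : (inner ℝ a (v i) : ℝ) = 0
    · simp [ha]
    · rw [Set.indicator_of_notMem (hi ha), mul_zero]
  rw [← Finset.sum_subset (Finset.subset_univ S) fun i _ hi => hrest i hi]
  refine Finset.sum_congr rfl fun i hi => ?_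
  have ha := ((memS i).1 hi).1
  have hmem := ((memS i).1 hi).2
  rw [Set.indicator_of_mem hmem]
  set P : ι → SignType := {j ∈ S | τ j < τ i}.piecewise (signVec v (x + a)) (signVec v x) with hP
  have hPj : ∀ j, j ≠ i → P j = signVec v (x + τ i • a) j := by
    intro j hj
    by_cases hjS : j ∈ S
    · have haj := ((memS j).1 hjS).1
      rcases lt_or_gt_of_ne fun h => hj (hinj j hjS i ha h) with h | h
      · rw [hP, Finset.piecewise_eq_of_mem _ _ _ (by simp [hjS, h]), e1, hline j _ haj,
          hline j _ haj, sign_pos (sub_pos.2 h), sign_pos (sub_pos.2 (hne j hjS).2)]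
      · rw [hP, Finset.piecewise_eq_of_notMem _ _ _ (by simp [h.le]), e0, hline j _ haj,
          hline j _ haj, sign_neg (sub_neg.2 h), sign_neg (sub_neg.2 (hne j hjS).1)]
    · rw [hP, Finset.piecewise_eq_of_notMem _ _ _ (by simp [hjS]), hoff j hjS _ hmem]
  have hupd : ∀ s, Function.update P i s = Function.update (signVec v (x + τ i • a)) i s := by
    intro s
    ext1 j
    rcases eq_or_ne j i with rfl | hj
    · simp
    · simp [hj, hPj j hj]
  have hPi : P = Function.update P i (signVec v x i) := by
    rw [eq_comm, Function.update_eq_self_iff, hP, Finset.piecewise_eq_of_notMem _ _ _ (by simp)]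
  have hlast : signVec v (x + a) i = SignType.sign (inner ℝ a (v i) : ℝ) := by
    rw [e1, hline i _ ha, sign_pos (sub_pos.2 (hne i hi).2), mul_one]
  have hfirst : signVec v x i = -SignType.sign (inner ℝ a (v i) : ℝ) := by
    rw [e0, hline i _ ha, sign_neg (sub_neg.2 (hne i hi).1), mul_neg, mul_one]
  rw [show Φ P = Φ (Function.update P i (signVec v x i)) from congrArg Φ hPi, hupd, hupd, hlast,
    hfirst]
  -- A crossing in the negative direction runs through the jump backwards.
  rcases lt_or_gt_of_ne ha with h | h
  · simp [sign_neg h, jump, hτ]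
  · simp [sign_pos h, jump, hτ]

theorem exists_bound_comp_signVec [Finite ι] (v : ι → V) (Φ : (ι → SignType) → ℂ) :
    ∃ C, ∀ x, ‖Φ (signVec v x)‖ ≤ C := by
  obtain ⟨C, hC⟩ := (Set.finite_range fun σ => ‖Φ σ‖).bddAbove
  exact ⟨C, fun x => hC ⟨_, rfl⟩⟩

end Crossing

/-! ### The change of an integral under translation. -/

section Master

variable {V : Type*} [NormedAddCommGroup V] [InnerProductSpace ℝ V]
variable [FiniteDimensional ℝ V] [MeasurableSpace V] [BorelSpace V]
variable {ι : Type*} [Fintype ι]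

theorem ae_inner_ne_zero {w : V} (hw : w ≠ 0) : ∀ᵐ x ∂(vol V), (inner ℝ w x : ℝ) ≠ 0 := by
  rw [ae_iff]
  convert vol_hyp hw using 2
  ext x
  simp [mem_hyp]

/-- Each clause excludes a hyperplane or a translate of one, hence a null set. In the last clause
the normal vector is nonzero because `v i`, `v j` are independent and the coefficient of `v j` is
not `0`. -/
theorem ae_isGeneric {v : ι → V} (hv : ∀ i, v i ≠ 0)
    (hind : ∀ i j, i ≠ j → LinearIndependent ℝ ![v i, v j]) (a : V) :
    ∀ᵐ x ∂(vol V), IsGeneric v a x := by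
  refine (ae_all_iff.2 fun i => ae_inner_ne_zero (hv i)).and (.and ?_ ?_)
  · refine ae_all_iff.2 fun i => ?_
    exact (measurePreserving_add_right (vol V) a).quasiMeasurePreserving.ae
      (ae_inner_ne_zero (hv i))
  · refine ae_all_iff.2 fun i => ae_all_iff.2 fun j => ae_all_iff.2 fun hij =>
      ae_all_iff.2 fun ha => ae_inner_ne_zero fun h => ha ?_
    have := LinearIndependent.pair_iff.1 (hind i j hij) (inner ℝ a (v j)) (-inner ℝ a (v i))
      (by rw [neg_smul, ← sub_eq_add_neg, h])
    simpa using this.2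

theorem measurable_comp_signVec (v : ι → V) (Φ : (ι → SignType) → ℂ) :
    Measurable fun x => Φ (signVec v x) := by
  let _ : MeasurableSpace SignType := ⊤
  have h : Measurable (signVec v) := by
    refine measurable_pi_lambda _ fun i => ?_
    have hs : Measurable (SignType.sign : ℝ → SignType) := by
      have : (SignType.sign : ℝ → SignType) =
          fun r => if 0 < r then 1 else if r < 0 then -1 else 0 := by
        funext r; exact sign_apply
      rw [this]
      exact Measurable.ite measurableSet_Ioi measurable_const
        (Measurable.ite measurableSet_Iio measurable_const measurable_const)
    exact hs.comp (by fun_prop)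
  have hd : DiscreteMeasurableSpace SignType := ⟨fun _ => trivial⟩
  exact (Measurable.of_discrete (f := Φ)).comp h

theorem measurable_jump [DecidableEq ι] (v : ι → V) (Φ : (ι → SignType) → ℂ) (i : ι) :
    Measurable (jump v Φ i) :=
  (measurable_comp_signVec v fun σ => Φ (Function.update σ i 1)).sub
    (measurable_comp_signVec v fun σ => Φ (Function.update σ i (-1)))

theorem integrable_comp_signVec_mul (v : ι → V) (Φ : (ι → SignType) → ℂ) {f : V → ℂ}
    (hf : Integrable f (vol V)) : Integrable (fun x => Φ (signVec v x) * f x) (vol V) := by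
  obtain ⟨C, hC⟩ := exists_bound_comp_signVec v Φ
  exact hf.bdd_mul (measurable_comp_signVec v Φ).aestronglyMeasurable (ae_of_all _ hC)

variable [DecidableEq ι]

theorem measurable_crossTime (a e : V) : Measurable (crossTime a e) := by
  unfold crossTime; fun_prop

theorem integrable_jump_mul (v : ι → V) (Φ : (ι → SignType) → ℂ) (i : ι) (a : V) {f : V → ℂ}
    (hf : Integrable f (vol V)) :
    Integrable (fun x => Set.indicator (Set.Icc 0 1) (fun t : ℝ => jump v Φ i (x + t • a))
          (crossTime a (v i) x) * f x) (vol V) := by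
  obtain ⟨C, hC⟩ := exists_bound_comp_signVec v fun σ => Φ (Function.update σ i 1)
  obtain ⟨C', hC'⟩ := exists_bound_comp_signVec v fun σ => Φ (Function.update σ i (-1))
  refine hf.bdd_mul (c := C + C') ?_ (ae_of_all _ fun x => ?_)
  · have h : Measurable fun x => jump v Φ i (x + crossTime a (v i) x • a) :=
      (measurable_jump v Φ i).comp
        (measurable_id.add ((measurable_crossTime a (v i)).smul_const a))
    exact (h.indicator (measurable_crossTime a (v i) measurableSet_Icc)).aestronglyMeasurable
  · refine (norm_indicator_le_norm_self _ _).trans ?_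
    exact (norm_sub_le _ _).trans (add_le_add (hC _) (hC' _))

/-- The integral of `jump v Φ i * f` over the region swept out by the hyperplane normal to `v i`
as it is translated by `-t • a`, `0 ≤ t ≤ 1`. -/
theorem integral_swept (v : ι → V) (hv : ∀ i, ‖v i‖ = 1) (Φ : (ι → SignType) → ℂ) (i : ι) (a : V)
    {f : V → ℂ} (hf : Integrable f (vol V)) :
    ∫ x, ((SignType.sign (inner ℝ a (v i) : ℝ) : ℝ) : ℂ) *
        (Set.indicator (Set.Icc 0 1) (fun t : ℝ => jump v Φ i (x + t • a))
          (crossTime a (v i) x)) * f x ∂(vol V) =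
      ((inner ℝ a (v i) : ℝ) : ℂ) * ∫ t in (0 : ℝ)..1, ∫ y : hyp (v i),
        jump v Φ i (y : V) * shift (t • a) f y ∂(vol (hyp (v i))) := by
  -- Here `crossTime` is a division by zero, but the factor `sign 0` kills the integrand.
  by_cases ha : (inner ℝ a (v i) : ℝ) = 0
  · simp [ha]
  have hi := integrable_jump_mul v Φ i a hf
  -- Started at `y - t a`, the line meets the hyperplane at time `t`, in the point `y`.
  have hpt : ∀ (t : ℝ) (y : hyp (v i)), Set.indicator (Set.Icc 0 1)
      (fun s : ℝ => jump v Φ i (((y : V) - t • a) + s • a)) (crossTime a (v i) ((y : V) - t • a)) *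
        f ((y : V) - t • a) =
      Set.indicator (Set.Icc 0 1) (fun _ : ℝ => jump v Φ i (y : V) * shift (t • a) f y) t := by
    intro t y
    have : crossTime a (v i) ((y : V) - t • a) = t := by
      rw [crossTime, inner_sub_right, mem_hyp.1 y.2, inner_smul_right, real_inner_comm a (v i)]
      field_simp
      ring
    rw [this, Set.indicator, Set.indicator]
    split_ifs <;> simp [shift]
  simp_rw [mul_assoc]
  rw [integral_const_mul, ← integral_translate (hv i) ha hi,
    integral_prod _ (integrable_translate (hv i) ha hi), ← mul_assoc, ← Complex.ofReal_mul]
  congr 1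
  · rw [sign_mul_abs]
  · rw [intervalIntegral.integral_of_le zero_le_one, ← integral_Icc_eq_integral_Ioc,
      ← integral_indicator measurableSet_Icc]
    refine integral_congr_ae (ae_of_all _ fun t => ?_)
    simp only [hpt]
    by_cases ht : t ∈ Set.Icc (0 : ℝ) 1 <;> simp only [ht, Set.indicator_of_mem,
      Set.indicator_of_notMem, not_false_eq_true, integral_zero]

/-- The change under translation of the integral of `f` against a function of the sign vector. -/
theorem integral_shift_sub (v : ι → V) (hv : ∀ i, ‖v i‖ = 1)
    (hind : ∀ i j, i ≠ j → LinearIndependent ℝ ![v i, v j]) (Φ : (ι → SignType) → ℂ) (a : V)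
    {f : V → ℂ} (hf : Integrable f (vol V)) :
    ∫ x, Φ (signVec v x) * shift a f x ∂(vol V) - ∫ x, Φ (signVec v x) * f x ∂(vol V) =
      ∑ i, ((inner ℝ a (v i) : ℝ) : ℂ) * ∫ t in (0 : ℝ)..1, ∫ y : hyp (v i),
        jump v Φ i (y : V) * shift (t • a) f y ∂(vol (hyp (v i))) := by
  have h1 : ∫ x, Φ (signVec v x) * shift a f x ∂(vol V) =
      ∫ x, Φ (signVec v (x + a)) * f x ∂(vol V) := by
    rw [← integral_add_right_eq_self (μ := vol V) _ a]
    simp [shift]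
  have hi1 : Integrable (fun x => Φ (signVec v (x + a)) * f x) (vol V) := by
    have := (integrable_comp_signVec_mul v Φ (hf.comp_sub_right a)).comp_add_right a
    simpa using this
  rw [h1, ← integral_sub hi1 (integrable_comp_signVec_mul v Φ hf)]
  rw [← Finset.sum_congr rfl fun i _ => integral_swept v hv Φ i a hf,
    ← integral_finsetSum]
  · refine integral_congr_ae ?_
    filter_upwards [ae_isGeneric (fun i h => by simpa [h] using hv i) hind a] with x hx
    rw [← sub_mul, jump_sum hx Φ, Finset.sum_mul]
  · intro i _
    simp_rw [mul_assoc]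
    exact (integrable_jump_mul v Φ i a hf).const_mul _

end Master

/-! ### Chambers as sets of constant sign vector. -/

section Chambers

variable {V : Type*} [NormedAddCommGroup V] [InnerProductSpace ℝ V]
variable {ι : Type*}

theorem mem_compl_iUnion_hyp {v : ι → V} {x : V} :
    x ∈ (⋃ H ∈ Set.range (fun i => hyp (v i)), (H : Set V))ᶜ ↔ ∀ i, (inner ℝ (v i) x : ℝ) ≠ 0 := by
  simp [mem_hyp]

/-- The set of all points with the same sign vector as `x`. -/
def cell (v : ι → V) (x : V) : Set V := {y | signVec v y = signVec v x}

theorem mem_cell_self (v : ι → V) (x : V) : x ∈ cell v x := rfl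

theorem mem_cell {v : ι → V} {x y : V} : y ∈ cell v x ↔ ∀ i, signVec v y i = signVec v x i :=
  funext_iff

theorem convex_sign_eq (w : V) (s : SignType) :
    Convex ℝ {y : V | SignType.sign (inner ℝ w y : ℝ) = s} := by
  have hl : IsLinearMap ℝ fun y : V => (inner ℝ w y : ℝ) := (innerSL ℝ w).toLinearMap.isLinear
  cases s
  · simpa [sign_eq_zero_iff] using! convex_hyperplane hl 0
  · simpa [sign_eq_neg_one_iff] using! convex_halfSpace_lt hl 0
  · simpa [sign_eq_one_iff] using! convex_halfSpace_gt hl 0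

theorem isOpen_sign_eq (w : V) {s : SignType} (hs : s ≠ 0) :
    IsOpen {y : V | SignType.sign (inner ℝ w y : ℝ) = s} := by
  cases s
  · exact absurd rfl hs
  · simpa [sign_eq_neg_one_iff] using!
      isOpen_lt (f := fun y : V => (inner ℝ w y : ℝ)) (by fun_prop) continuous_const
  · simpa [sign_eq_one_iff] using!
      isOpen_lt continuous_const (g := fun y : V => (inner ℝ w y : ℝ)) (by fun_prop)

theorem cell_eq_iInter (v : ι → V) (x : V) :
    cell v x = ⋂ i, {y | SignType.sign (inner ℝ (v i) y : ℝ) = signVec v x i} := by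
  ext y; simp [mem_cell, signVec]

theorem convex_cell (v : ι → V) (x : V) : Convex ℝ (cell v x) := by
  rw [cell_eq_iInter]
  exact convex_iInter fun i => convex_sign_eq _ _

theorem isOpen_cell [Finite ι] {v : ι → V} {x : V} (hx : ∀ i, (inner ℝ (v i) x : ℝ) ≠ 0) :
    IsOpen (cell v x) := by
  rw [cell_eq_iInter]
  exact isOpen_iInter_of_finite fun i => isOpen_sign_eq _ (sign_ne_zero.2 (hx i))

theorem inner_ne_zero_of_mem_cell {v : ι → V} {x y : V} (hx : ∀ i, (inner ℝ (v i) x : ℝ) ≠ 0)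
    (hy : y ∈ cell v x) (i : ι) : (inner ℝ (v i) y : ℝ) ≠ 0 := by
  rw [← sign_ne_zero]
  exact (mem_cell.1 hy i).trans_ne (sign_ne_zero.2 (hx i))

/-- A nonvanishing sign is constant on a connected set; conversely a cell is convex, hence
connected. -/
theorem connectedComponentIn_eq_cell {v : ι → V} {x : V}
    (hx : ∀ i, (inner ℝ (v i) x : ℝ) ≠ 0) :
    connectedComponentIn (⋃ H ∈ Set.range (fun i => hyp (v i)), (H : Set V))ᶜ x = cell v x := by
  have hxC := mem_compl_iUnion_hyp.2 hx
  refine Set.Subset.antisymm (fun y hy => mem_cell.2 fun i => ?_) ?_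
  · refine isPreconnected_connectedComponentIn.constant (f := fun z => signVec v z i) ?_ hy
      (mem_connectedComponentIn hxC)
    intro z hz
    have hz' := mem_compl_iUnion_hyp.1 (connectedComponentIn_subset _ _ hz) i
    exact ((continuousAt_sign_of_ne_zero hz').comp
      (f := fun z => (inner ℝ (v i) z : ℝ)) (by fun_prop)).continuousWithinAt
  · exact (convex_cell v x).isPreconnected.subset_connectedComponentIn (mem_cell_self v x)
      fun y hy => mem_compl_iUnion_hyp.2 (inner_ne_zero_of_mem_cell hx hy)

theorem mem_chambers_iff {v : ι → V} {T : Set V} :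
    T ∈ chambers (Set.range fun i => hyp (v i)) ↔
      ∃ x, (∀ i, (inner ℝ (v i) x : ℝ) ≠ 0) ∧ T = cell v x := by
  constructor
  · rintro ⟨x, hx, rfl⟩
    have hx' := mem_compl_iUnion_hyp.1 hx
    exact ⟨x, hx', connectedComponentIn_eq_cell hx'⟩
  · rintro ⟨x, hx, rfl⟩
    exact ⟨x, mem_compl_iUnion_hyp.2 hx, (connectedComponentIn_eq_cell hx).symm⟩

theorem cell_eq_of_mem {v : ι → V} {x y : V} (hy : y ∈ cell v x) : cell v y = cell v x := by
  unfold cell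
  rw [show signVec v y = signVec v x from hy]

theorem finite_chambers [Finite ι] (v : ι → V) :
    (chambers (Set.range fun i => hyp (v i))).Finite := by
  refine (Set.finite_range fun σ : ι → SignType => {y | signVec v y = σ}).subset ?_
  intro T hT
  obtain ⟨x, -, rfl⟩ := mem_chambers_iff.1 hT
  exact ⟨signVec v x, rfl⟩

theorem pairwiseDisjoint_chambers (v : ι → V) :
    (chambers (Set.range fun i => hyp (v i))).PairwiseDisjoint id := by
  intro S hS T hT hne
  obtain ⟨x, -, rfl⟩ := mem_chambers_iff.1 hS
  obtain ⟨y, -, rfl⟩ := mem_chambers_iff.1 hT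
  refine Set.disjoint_left.2 fun z hz hz' => hne ?_
  rw [← cell_eq_of_mem hz, ← cell_eq_of_mem hz']

theorem separates_hyp_iff {w : V} {S T : Set V} {s t : SignType} (hs : s ≠ 0) (ht : t ≠ 0)
    (hS : ∀ x ∈ S, SignType.sign (inner ℝ w x : ℝ) = s) (hSne : S.Nonempty)
    (hT : ∀ x ∈ T, SignType.sign (inner ℝ w x : ℝ) = t) (hTne : T.Nonempty) :
    Separates (hyp w) S T ↔ s ≠ t := by
  obtain ⟨x, hx⟩ := hSne
  obtain ⟨y, hy⟩ := hTne
  constructor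
  · rintro ⟨u, hu, hu1, hu2⟩ hst
    have h1 := hu1 x hx
    have h2 := hu2 y hy
    -- A positive multiple of the point where the segment from `x` to `y` meets the hyperplane. If
    -- `w` had the same strict sign at both ends, convexity would forbid it.
    set z := (-(inner ℝ u y : ℝ)) • x + (inner ℝ u x : ℝ) • y with hz
    have hzu : z ∈ hyp u := by
      rw [mem_hyp, hz, inner_add_right, inner_smul_right, inner_smul_right]; ring
    have hzw : z ∈ hyp w := by rw [hu]; exact hzu
    have hzs : z ∈ {z | SignType.sign (inner ℝ w z : ℝ) = s} := by
      have hd : 0 < -(inner ℝ u y : ℝ) + inner ℝ u x := by linarith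
      have hconv := convex_sign_eq w s (hS x hx) (hst ▸ hT y hy)
        (div_nonneg (neg_nonneg.2 h2.le) hd.le) (div_nonneg h1.le hd.le)
        (by rw [← add_div, div_self hd.ne'])
      rw [Set.mem_ofPred_eq, div_eq_inv_mul, div_eq_inv_mul, mul_smul, mul_smul, ← smul_add, ← hz,
        inner_smul_right, sign_mul, sign_pos (inv_pos.2 hd), one_mul] at hconv
      exact hconv
    rw [Set.mem_ofPred_eq, mem_hyp.1 hzw, sign_zero] at hzs
    exact hs hzs.symm
  · intro hst
    have key : ∀ u : V, hyp w = hyp u →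
        (∀ x ∈ S, SignType.sign (inner ℝ u x : ℝ) = 1) →
        (∀ y ∈ T, SignType.sign (inner ℝ u y : ℝ) = -1) → Separates (hyp w) S T :=
      fun u h h1 h2 => ⟨u, h, fun x hx => sign_eq_one_iff.1 (h1 x hx),
        fun y hy => sign_eq_neg_one_iff.1 (h2 y hy)⟩
    have hneg : hyp w = hyp (-w) := by ext z; simp [mem_hyp]
    cases s <;> cases t <;> first
      | exact absurd rfl hs
      | exact absurd rfl ht
      | exact absurd rfl hst
      | exact key w rfl hS hT
      | refine key (-w) hneg (fun x hx => ?_) fun y hy => ?_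
        · rw [inner_neg_left, Left.sign_neg, hS x hx]; rfl
        · rw [inner_neg_left, Left.sign_neg, hT y hy]; rfl

open Classical in
theorem chamberSign_eq_prod {A : Finset (Submodule ℝ V)} (S T : Set V) :
    chamberSign (A : Set (Submodule ℝ V)) S T = ∏ H ∈ A, if Separates H S T then -1 else 1 := by
  rw [Finset.prod_ite, Finset.prod_const_one, mul_one, Finset.prod_const, chamberSign,
    ← Set.ncard_coe_finset]
  congr 2
  ext H
  simp [separationSet]

variable [FiniteDimensional ℝ V] [MeasurableSpace V] [BorelSpace V]

/-- The chambers are finitely many, disjoint, and cover almost everything. Agreement of `s` with the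
sign is asked only almost everywhere, since on an even restricted arrangement the `s` in use
vanishes on the odd-multiplicity intersections, which cut through chambers. -/
theorem pizza_eq_integral [Finite ι] {v : ι → V} (hv : ∀ i, v i ≠ 0) (T₀ : Set V) {g s : V → ℂ}
    (hg : Integrable g (vol V))
    (hs : ∀ T ∈ chambers (Set.range fun i => hyp (v i)), ∀ᵐ x ∂(vol V), x ∈ T →
      s x = chamberSign (Set.range fun i => hyp (v i)) T₀ T) :
    pizza (Set.range fun i => hyp (v i)) T₀ g = ∫ x, s x * g x ∂(vol V) := by
  have hfin := finite_chambers v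
  have hmeas : ∀ T ∈ chambers (Set.range fun i => hyp (v i)), MeasurableSet T := by
    intro T hT
    obtain ⟨x, hx, rfl⟩ := mem_chambers_iff.1 hT
    exact (isOpen_cell hx).measurableSet
  have hcongr : ∀ T ∈ chambers (Set.range fun i => hyp (v i)),
      (fun x => s x * g x) =ᵐ[(vol V).restrict T]
        fun x => (chamberSign (Set.range fun i => hyp (v i)) T₀ T : ℂ) * g x := by
    intro T hT
    filter_upwards [(ae_restrict_iff' (hmeas T hT)).2 (hs T hT)] with x hx
    rw [hx]
  have hcover : ∀ᵐ x ∂(vol V), x ∈ ⋃ T ∈ hfin.toFinset, T := by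
    filter_upwards [ae_all_iff.2 fun i => ae_inner_ne_zero (hv i)] with x hx
    simp only [Set.mem_iUnion, Set.Finite.mem_toFinset]
    exact ⟨_, mem_chambers_iff.2 ⟨x, hx, rfl⟩, mem_cell_self v x⟩
  rw [pizza, finsum_mem_eq_finite_toFinset_sum _ hfin,
    ← Measure.restrict_eq_self_of_ae_mem hcover, integral_biUnion_finset]
  · rw [Measure.restrict_eq_self_of_ae_mem hcover]
    refine Finset.sum_congr rfl fun T hT => ?_
    rw [integral_congr_ae (hcongr T (hfin.mem_toFinset.1 hT)), integral_const_mul]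
  · exact fun T hT => hmeas T (hfin.mem_toFinset.1 hT)
  · intro S hS T hT hne
    exact pairwiseDisjoint_chambers v (hfin.mem_toFinset.1 hS) (hfin.mem_toFinset.1 hT) hne
  · intro T hT
    exact (hg.integrableOn.const_mul _).congr (hcongr T (hfin.mem_toFinset.1 hT)).symm

/-- A non-empty open set meets the complement of finitely many hyperplanes. -/
theorem exists_mem_inner_ne_zero [Finite ι] {v : ι → V} (hv : ∀ i, v i ≠ 0) {Z : Set V}
    (hZ : IsOpen Z) (hne : Z.Nonempty) : ∃ x ∈ Z, ∀ i, (inner ℝ (v i) x : ℝ) ≠ 0 := by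
  have h : ∀ᵐ x ∂(vol V), ∀ i, (inner ℝ (v i) x : ℝ) ≠ 0 :=
    ae_all_iff.2 fun i => ae_inner_ne_zero (hv i)
  exact (Measure.dense_of_ae h).inter_open_nonempty Z hZ hne

end Chambers

/-! ### Chamber signs as products of signs. -/

section Signs

open Classical

variable {V : Type*} [NormedAddCommGroup V] [InnerProductSpace ℝ V]

theorem exists_smul_eq_of_hyp_le {u w : V} (h : hyp u ≤ hyp w) : ∃ c : ℝ, c • u = w := by
  have := Submodule.orthogonal_le_orthogonal_iff.1 h
  exact Submodule.mem_span_singleton.1 (this (Submodule.mem_span_singleton_self w))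

theorem hyp_eq_of_le {u w : V} (hw : w ≠ 0) (h : hyp u ≤ hyp w) : hyp u = hyp w := by
  obtain ⟨c, rfl⟩ := exists_smul_eq_of_hyp_le h
  have hc : c ≠ 0 := fun hc => hw (by simp [hc])
  ext x
  simp [mem_hyp, inner_smul_left, hc]

theorem injOn_hyp {E : Finset V} (hunit : ∀ e ∈ E, ‖e‖ = 1)
    (hindep : ∀ e ∈ E, ∀ e' ∈ E, e ≠ e' → LinearIndependent ℝ ![e, e']) :
    Set.InjOn (hyp : V → Submodule ℝ V) E := by
  intro e he e' he' h
  by_contra hne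
  have he0 : e ≠ 0 := by rintro rfl; simpa using hunit 0 he
  obtain ⟨c, hc⟩ := exists_smul_eq_of_hyp_le h.le
  exact (LinearIndependent.pair_iff' he0).1 (hindep e he e' he' hne) c hc

theorem arr_eq_range (E : Finset V) : arr E = Set.range fun i : E => hyp (i : V) := by
  ext H; simp [arr, eq_comm]

/-- The product of the signs of `x` with respect to all vectors of `E`. -/
noncomputable def signProd (E : Finset V) (x : V) : ℤ :=
  ∏ g ∈ E, (SignType.sign (inner ℝ g x : ℝ) : ℤ)

/-- All of `E` is positive on `T₀`, so `H_g` separates exactly when `g` is negative on `T`. -/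
theorem chamberSign_arr {E : Finset V} (hinj : Set.InjOn (hyp : V → Submodule ℝ V) E)
    {T₀ T : Set V} (hne : T₀.Nonempty) (hpos : ∀ e ∈ E, ∀ x ∈ T₀, 0 < (inner ℝ e x : ℝ)) {x : V}
    (hxT : x ∈ T) (hx : ∀ g ∈ E, (inner ℝ g x : ℝ) ≠ 0)
    (hT : ∀ y ∈ T, ∀ g ∈ E, SignType.sign (inner ℝ g y : ℝ) = SignType.sign (inner ℝ g x : ℝ)) :
    chamberSign (arr E) T₀ T = signProd E x := by
  have hA : arr E = ((E.image hyp : Finset (Submodule ℝ V)) : Set (Submodule ℝ V)) := by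
    ext H; simp [arr, eq_comm]
  rw [hA, chamberSign_eq_prod, Finset.prod_image hinj, signProd]
  refine Finset.prod_congr rfl fun g hg => ?_
  rw [separates_hyp_iff (s := 1) (by decide) (sign_ne_zero.2 (hx g hg))
    (fun y hy => sign_pos (hpos g hg y hy)) hne (fun y hy => hT y hy g hg) ⟨x, hxT⟩]
  rcases lt_or_gt_of_ne (hx g hg) with h | h
  · rw [sign_neg h]; simp
  · rw [sign_pos h]; simp

theorem eventually_sign_add {w x : V} (hx : (inner ℝ w x : ℝ) ≠ 0) (u : V) :
    ∀ᶠ ε in 𝓝[>] (0 : ℝ),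
      SignType.sign (inner ℝ w (x + ε • u) : ℝ) = SignType.sign (inner ℝ w x : ℝ) := by
  have hc : Tendsto (fun ε : ℝ => x + ε • u) (𝓝[>] 0) (𝓝 x) := by
    have : Continuous fun ε : ℝ => x + ε • u := by fun_prop
    exact (this.tendsto' 0 x (by simp)).mono_left nhdsWithin_le_nhds
  exact hc.eventually ((isOpen_sign_eq w (sign_ne_zero.2 hx)).mem_nhds rfl)

/-- The product of the signs of `x` with respect to the vectors of `E` other than `e`. -/
noncomputable def offProd (E : Finset V) (e x : V) : ℤ := signProd (E.erase e) x

theorem offProd_mul_self {E : Finset V} {e x : V}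
    (hx : ∀ g ∈ E, g ≠ e → (inner ℝ g x : ℝ) ≠ 0) : offProd E e x * offProd E e x = 1 := by
  rw [offProd, signProd, ← Finset.prod_mul_distrib]
  refine Finset.prod_eq_one fun g hg => ?_
  rw [Finset.mem_erase] at hg
  rcases lt_or_gt_of_ne (hx g hg.2 hg.1) with h | h
  · simp [sign_neg h]
  · simp [sign_pos h]

theorem offProd_congr {E : Finset V} {e x y : V} (h : ∀ g ∈ E, g ≠ e →
    SignType.sign (inner ℝ g x : ℝ) = SignType.sign (inner ℝ g y : ℝ)) :
    offProd E e x = offProd E e y := by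
  refine Finset.prod_congr rfl fun g hg => ?_
  rw [Finset.mem_erase] at hg
  rw [h g hg.2 hg.1]

/-- A small step along `e` from `F ⊆ H_e` makes the sign of `e` equal to `1` and leaves the other,
nonzero, signs alone. -/
theorem compSign_eq {E : Finset V} (hunit : ∀ e ∈ E, ‖e‖ = 1)
    (hinj : Set.InjOn (hyp : V → Submodule ℝ V) E)
    {T₀ F : Set V} (hne : T₀.Nonempty) (hpos : ∀ e ∈ E, ∀ x ∈ T₀, 0 < (inner ℝ e x : ℝ)) {e y : V}
    (he : e ∈ E) (hFe : ∀ x ∈ F, (inner ℝ e x : ℝ) = 0) (hyF : y ∈ F)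
    (hy : ∀ g ∈ E, g ≠ e → (inner ℝ g y : ℝ) ≠ 0)
    (hF : ∀ x ∈ F, ∀ g ∈ E, g ≠ e →
      SignType.sign (inner ℝ g x : ℝ) = SignType.sign (inner ℝ g y : ℝ)) :
    compSign E T₀ F e = offProd E e y := by
  have hev : ∀ x ∈ F, ∀ᶠ ε in 𝓝[>] (0 : ℝ), ∀ g ∈ E,
      SignType.sign (inner ℝ g (x + ε • e) : ℝ) =
        if g = e then 1 else SignType.sign (inner ℝ g y : ℝ) := by
    intro x hx
    refine (eventually_all_finset E).2 fun g hg => ?_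
    by_cases hge : g = e
    · subst hge
      filter_upwards [self_mem_nhdsWithin] with ε hε
      rw [if_pos rfl, inner_add_right, hFe x hx, inner_smul_right, real_inner_self_eq_norm_sq,
        hunit g hg]
      exact sign_pos (by simpa using hε)
    · rw [if_neg hge, ← hF x hx g hg hge]
      refine eventually_sign_add (fun h => hy g hg hge ?_) e
      rw [← sign_eq_zero_iff, ← hF x hx g hg hge, h, sign_zero]
  have hmem : ∀ z, z ∈ faceComp E F e ↔ ∀ g ∈ E, SignType.sign (inner ℝ g z : ℝ) =
      if g = e then 1 else SignType.sign (inner ℝ g y : ℝ) := by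
    intro z
    constructor
    · intro hz g hg
      obtain ⟨ε, h1, h2⟩ := ((hz y hyF).and (hev y hyF)).exists
      rw [h1 g hg, h2 g hg]
    · intro hz x hx
      filter_upwards [hev x hx] with ε hε g hg
      rw [hz g hg, hε g hg]
  obtain ⟨ε, hε⟩ := (hev y hyF).exists
  have hz := (hmem _).2 hε
  rw [compSign, chamberSign_arr hinj hne hpos hz, signProd, ← Finset.mul_prod_erase _ _ he, offProd,
    signProd, hε e he]
  · simp only [if_true, SignType.coe_one, one_mul]
    refine Finset.prod_congr rfl fun g hg => ?_
    rw [Finset.mem_erase] at hg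
    rw [hε g hg.2, if_neg hg.1]
  · intro g hg
    rw [← sign_ne_zero, hε g hg]
    split_ifs with h
    · decide
    · exact sign_ne_zero.2 (hy g hg h)
  · intro w hw g hg
    rw [(hmem w).1 hw g hg, hε g hg]

end Signs

/-! ### The facets of a chamber are its non-empty walls. -/

section Facets

open Classical

variable {V : Type*} [NormedAddCommGroup V] [InnerProductSpace ℝ V]

theorem le_span_of_eventually {U : Set V} {K : Submodule ℝ V} {x : V} (hx : x ∈ U)
    (h : ∀ w ∈ K, ∀ᶠ ε in 𝓝[>] (0 : ℝ), x + ε • w ∈ U) : K ≤ Submodule.span ℝ U := by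
  intro w hw
  obtain ⟨ε, h1, h2⟩ := ((h w hw).and self_mem_nhdsWithin).exists
  have h3 : ε • w ∈ Submodule.span ℝ U := by
    have := sub_mem (Submodule.subset_span (R := ℝ) h1) (Submodule.subset_span hx)
    simpa using this
  exact (Submodule.smul_mem_iff _ (ne_of_gt (Set.mem_Ioi.1 h2))).1 h3

/-- The set of the points of `H_e` that are on the same side as `x` of the other hyperplanes. -/
def wall (E : Finset V) (x e : V) : Set V :=
  {y | (inner ℝ e y : ℝ) = 0 ∧ ∀ g ∈ E, g ≠ e →
    SignType.sign (inner ℝ g y : ℝ) = SignType.sign (inner ℝ g x : ℝ)}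

theorem wall_subset_hyp (E : Finset V) (x e : V) : wall E x e ⊆ (hyp e : Set V) :=
  fun _ hy => mem_hyp.2 hy.1

theorem eq_of_wall_subset_hyp {E : Finset V} {x e g : V} (hx : ∀ g ∈ E, (inner ℝ g x : ℝ) ≠ 0)
    (hne : (wall E x e).Nonempty) (hg : g ∈ E) (h : wall E x e ⊆ (hyp g : Set V)) : g = e := by
  obtain ⟨y, hy⟩ := hne
  by_contra hge
  refine hx g hg ?_
  rw [← sign_eq_zero_iff, ← hy.2 g hg hge, mem_hyp.1 (h hy), sign_zero]

variable [FiniteDimensional ℝ V]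

theorem wall_mem_facets {E : Finset V} (hunit : ∀ e ∈ E, ‖e‖ = 1) {x e : V} (he : e ∈ E)
    (hx : ∀ g ∈ E, (inner ℝ g x : ℝ) ≠ 0) (hne : (wall E x e).Nonempty) :
    wall E x e ∈ facets E {y | ∀ g ∈ E,
      SignType.sign (inner ℝ g y : ℝ) = SignType.sign (inner ℝ g x : ℝ)} := by
  refine ⟨⟨hne, fun g => if g = e then 0 else SignType.sign (inner ℝ g x : ℝ), ?_⟩, ?_, ?_⟩
  · ext y
    constructor
    · rintro ⟨h1, h2⟩ g hg
      by_cases hge : g = e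
      · subst hge; simp [h1]
      · simp [hge, h2 g hg hge]
    · intro h
      refine ⟨by simpa using h e he, fun g hg hge => by simpa [hge] using h g hg⟩
  · have hspan : Submodule.span ℝ (wall E x e) = hyp e := by
      refine le_antisymm (Submodule.span_le.2 (wall_subset_hyp E x e)) ?_
      obtain ⟨y, hy⟩ := hne
      refine le_span_of_eventually hy fun w hw => ?_
      have hev := (eventually_all_finset (l := 𝓝[>] (0 : ℝ)) (p := fun g ε =>
        SignType.sign (inner ℝ g (y + ε • w) : ℝ) = SignType.sign (inner ℝ g y : ℝ))
          (E.erase e)).2 fun g hg => by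
        rw [Finset.mem_erase] at hg
        refine eventually_sign_add ?_ w
        rw [← sign_ne_zero, hy.2 g hg.2 hg.1]
        exact sign_ne_zero.2 (hx g hg.2)
      filter_upwards [hev] with ε hε
      refine ⟨?_, fun g hg hge => ?_⟩
      · rw [inner_add_right, hy.1, inner_smul_right, mem_hyp.1 hw]; simp
      · rw [hε g (Finset.mem_erase.2 ⟨hge, hg⟩), hy.2 g hg hge]
    have he0 : e ≠ 0 := by rintro rfl; simpa using hunit 0 he
    have := Submodule.finrank_add_finrank_orthogonal (Submodule.span ℝ {e})
    rw [finrank_span_singleton he0] at this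
    rw [hspan, hyp, add_comm]
    exact this
  · intro y hy
    -- Moving from the wall along `s • e` leads to the side of `H_e` containing `x`.
    set s : ℝ := (SignType.sign (inner ℝ e x : ℝ) : ℝ) with hs
    have hc : Tendsto (fun ε : ℝ => y + ε • s • e) (𝓝[>] 0) (𝓝 y) := by
      have : Continuous fun ε : ℝ => y + ε • s • e := by fun_prop
      exact (this.tendsto' 0 y (by simp)).mono_left nhdsWithin_le_nhds
    refine mem_closure_of_tendsto hc ((eventually_all_finset E).2 fun g hg => ?_)
    by_cases hge : g = e
    · subst hge
      filter_upwards [self_mem_nhdsWithin] with ε hε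
      rw [inner_add_right, hy.1, inner_smul_right, inner_smul_right, real_inner_self_eq_norm_sq,
        hunit g hg, zero_add, sign_mul, sign_pos hε, hs]
      rcases lt_or_gt_of_ne (hx g hg) with h | h
      · simp [sign_neg h]
      · simp [sign_pos h]
    · rw [← hy.2 g hg hge]
      refine eventually_sign_add ?_ _
      rw [← sign_ne_zero, hy.2 g hg hge]
      exact sign_ne_zero.2 (hx g hg)

/-- A dimension count: with no zero sign `U` is open and spans `V`; with two it lies in codimension
two. So exactly one sign is zero. The others are open conditions at points of the closure of the
chamber, hence agree with those of `x`. -/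
theorem exists_eq_wall {E : Finset V}
    (hindep : ∀ e ∈ E, ∀ e' ∈ E, e ≠ e' → LinearIndependent ℝ ![e, e']) {x : V} {U : Set V}
    (hU : U ∈ facets E {y | ∀ g ∈ E,
      SignType.sign (inner ℝ g y : ℝ) = SignType.sign (inner ℝ g x : ℝ)}) :
    ∃ e ∈ E, U = wall E x e := by
  obtain ⟨⟨⟨y, hy⟩, σ, hσ⟩, hrank, hcl⟩ := hU
  have hmem : ∀ z, z ∈ U ↔ ∀ e ∈ E, SignType.sign (inner ℝ e z : ℝ) = σ e := by
    intro z; rw [hσ]; rfl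
  have hzero : ∃ e ∈ E, σ e = 0 := by
    by_contra! hnz
    have htop : (⊤ : Submodule ℝ V) ≤ Submodule.span ℝ U := by
      refine le_span_of_eventually hy fun w _ => ?_
      simp only [hmem]
      refine (eventually_all_finset E).2 fun g hg => ?_
      have hg' := (hmem y).1 hy g hg
      rw [← hg']
      exact eventually_sign_add (by rw [← sign_ne_zero, hg']; exact hnz g hg) w
    rw [top_le_iff.1 htop, finrank_top] at hrank
    omega
  obtain ⟨e, he, hσe⟩ := hzero
  have hother : ∀ g ∈ E, g ≠ e → σ g ≠ 0 := by
    intro g hg hge hσg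
    have hle : Submodule.span ℝ U ≤ (Submodule.span ℝ (Set.range ![e, g]))ᗮ := by
      rw [Submodule.span_le]
      intro z hz
      rw [SetLike.mem_coe, Submodule.mem_orthogonal]
      have h1 := sign_eq_zero_iff.1 (((hmem z).1 hz e he).trans hσe)
      have h2 := sign_eq_zero_iff.1 (((hmem z).1 hz g hg).trans hσg)
      intro u hu
      rw [Matrix.range_cons_cons_empty] at hu
      obtain ⟨b, c, rfl⟩ := Submodule.mem_span_pair.1 hu
      rw [inner_add_left, inner_smul_left, inner_smul_left, h1, h2]; simp
    have h1 := Submodule.finrank_mono hle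
    have h2 := Submodule.finrank_add_finrank_orthogonal (Submodule.span ℝ (Set.range ![e, g]))
    rw [finrank_span_eq_card (hindep e he g hg hge.symm), Fintype.card_fin] at h2
    omega
  have hsame : ∀ g ∈ E, g ≠ e → σ g = SignType.sign (inner ℝ g x : ℝ) := by
    intro g hg hge
    have hn := (isOpen_sign_eq g (hother g hg hge)).mem_nhds ((hmem y).1 hy g hg)
    obtain ⟨z, hz1, hz2⟩ := mem_closure_iff_nhds.1 (hcl hy) _ hn
    exact hz1.symm.trans (hz2 g hg)
  refine ⟨e, he, ?_⟩
  ext z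
  rw [hmem]
  constructor
  · intro h
    exact ⟨sign_eq_zero_iff.1 ((h e he).trans hσe), fun g hg hge =>
      (h g hg).trans (hsame g hg hge)⟩
  · rintro ⟨h1, h2⟩ g hg
    by_cases hge : g = e
    · subst hge; rw [h1, hσe, sign_zero]
    · rw [h2 g hg hge, hsame g hg hge]

end Facets

/-! ### Restricted arrangements and the parity of multiplicities. -/

section Restriction

open Classical

variable {V : Type*} [NormedAddCommGroup V] [InnerProductSpace ℝ V]

theorem chamberSign_self {A : Set (Submodule ℝ V)} {Z : Set V} (hZ : Z.Nonempty) :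
    chamberSign A Z Z = 1 := by
  have : separationSet A Z Z = ∅ := by
    ext H
    simp only [separationSet, Set.mem_ofPred_eq, Set.mem_empty_iff_false, iff_false, not_and]
    rintro - ⟨v, -, h1, h2⟩
    obtain ⟨z, hz⟩ := hZ
    exact lt_asymm (h1 z hz) (h2 z hz)
  simp [chamberSign, this]

/-- The vectors of `E` that give the even restricted arrangement. -/
noncomputable def evenPart (E : Finset V) (e : V) : Finset V :=
  {g ∈ E.erase e | Even (interMult E (hyp e ⊓ hyp g))}

theorem evenPart_subset (E : Finset V) (e : V) : evenPart E e ⊆ E.erase e :=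
  Finset.filter_subset _ _

theorem compSign_restricted_chamber {E : Finset V} (hunit : ∀ e ∈ E, ‖e‖ = 1)
    (hinj : Set.InjOn (hyp : V → Submodule ℝ V) E)
    {T₀ : Set V} (hne : T₀.Nonempty) (hpos : ∀ e ∈ E, ∀ x ∈ T₀, 0 < (inner ℝ e x : ℝ)) {e : V}
    (he : e ∈ E) {U : Set (hyp e)} {y : hyp e} (hyU : y ∈ U)
    (hy : ∀ g ∈ E, g ≠ e → (inner ℝ g (y : V) : ℝ) ≠ 0)
    (hU : ∀ z ∈ U, ∀ g ∈ E, g ≠ e →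
      SignType.sign (inner ℝ g (z : V) : ℝ) = SignType.sign (inner ℝ g (y : V) : ℝ)) :
    compSign E T₀ (((↑) : hyp e → V) '' U) e = offProd E e y := by
  refine compSign_eq hunit hinj hne hpos he ?_ ⟨y, hyU, rfl⟩ hy ?_
  · rintro _ ⟨z, -, rfl⟩; exact mem_hyp.1 z.2
  · rintro _ ⟨z, hz, rfl⟩; exact hU z hz

theorem signProd_eq_prod (E : Finset V) (x : V) :
    signProd E x = ∏ i : E, (signVec (fun g : E => (g : V)) x i : ℤ) :=
  (Finset.prod_coe_sort E fun g => (SignType.sign (inner ℝ g x : ℝ) : ℤ)).symm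

theorem prod_update_signVec {E : Finset V} (e : E) (x : V) (s : SignType) :
    ∏ i : E, (Function.update (signVec (fun g : E => (g : V)) x) e s i : ℤ) =
      s * offProd E e x := by
  have h : ∀ i : E, (Function.update (signVec (fun g : E => (g : V)) x) e s i : ℤ) =
      (fun g : V => if g = e then (s : ℤ) else (SignType.sign (inner ℝ g x : ℝ) : ℤ)) i := by
    intro i
    by_cases hi : i = e
    · subst hi; simp
    · have : (i : V) ≠ e := fun h => hi (Subtype.ext h)
      simp [hi, signVec]
  rw [Finset.prod_congr rfl fun i _ => h i, Finset.prod_coe_sort E fun g : V =>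
    if g = e then (s : ℤ) else (SignType.sign (inner ℝ g x : ℝ) : ℤ),
    ← Finset.mul_prod_erase _ _ e.2, if_pos rfl, offProd, signProd]
  congr 1
  refine Finset.prod_congr rfl fun g hg => ?_
  rw [if_neg (Finset.mem_erase.1 hg).1]

theorem cell_coe_eq (E : Finset V) (x : V) : cell (fun i : E => (i : V)) x =
    {y | ∀ g ∈ E, SignType.sign (inner ℝ g y : ℝ) = SignType.sign (inner ℝ g x : ℝ)} := by
  ext y; simp [mem_cell, signVec]

variable [FiniteDimensional ℝ V]

/-- The orthogonal projections to `H_e` of the vectors of `F`. They are normal, inside `H_e`, to the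
intersections of `H_e` with the hyperplanes of `F`. -/
noncomputable def resNormal (e : V) (F : Finset V) : F → hyp e :=
  fun g => (hyp e).orthogonalProjectionOnto (g : V)

theorem inner_resNormal {e : V} {F : Finset V} (g : F) (y : hyp e) :
    (inner ℝ (resNormal e F g) y : ℝ) = inner ℝ (g : V) (y : V) :=
  Submodule.inner_orthogonalProjectionOnto_eq_of_mem_right y (g : V)

theorem signVec_resNormal {e : V} {F : Finset V} (g : F) (y : hyp e) :
    signVec (resNormal e F) y g = SignType.sign (inner ℝ (g : V) (y : V) : ℝ) := by
  rw [signVec, inner_resNormal]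

theorem hyp_resNormal {e : V} {F : Finset V} (g : F) :
    hyp (resNormal e F g) = (hyp (g : V)).comap (hyp e).subtype := by
  ext y
  rw [mem_hyp, inner_resNormal, Submodule.mem_comap, mem_hyp]
  rfl

/-- A zero projection would give `H_e ⊆ H_g`, making `g` a multiple of `e`. -/
theorem resNormal_ne_zero {E : Finset V} (hunit : ∀ e ∈ E, ‖e‖ = 1)
    (hindep : ∀ e ∈ E, ∀ e' ∈ E, e ≠ e' → LinearIndependent ℝ ![e, e']) {e : V} (he : e ∈ E)
    {F : Finset V} (hF : F ⊆ E.erase e) (g : F) : resNormal e F g ≠ 0 := by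
  intro h
  obtain ⟨hge, hg⟩ := Finset.mem_erase.1 (hF g.2)
  have hle : hyp e ≤ hyp (g : V) := by
    intro y hy
    rw [mem_hyp, ← inner_resNormal g ⟨y, hy⟩, h, inner_zero_left]
  obtain ⟨c, hc⟩ := exists_smul_eq_of_hyp_le hle
  have he0 : e ≠ 0 := by rintro rfl; simpa using hunit 0 he
  exact (LinearIndependent.pair_iff' he0).1 (hindep e he g hg (Ne.symm hge)) c hc

theorem restrictedArr_eq_range (E : Finset V) (e : V) :
    restrictedArr E e = Set.range fun g => hyp (resNormal e (E.erase e) g) := by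
  simp_rw [hyp_resNormal]
  ext W
  simp only [restrictedArr, Set.mem_ofPred_eq, Set.mem_range, Subtype.exists, Finset.mem_erase,
    exists_prop]
  constructor
  · rintro ⟨g, h1, h2, h4⟩; exact ⟨g, ⟨h2, h1⟩, h4.symm⟩
  · rintro ⟨g, ⟨h2, h1⟩, h4⟩; exact ⟨g, h1, h2, h4.symm⟩

theorem evenArr_eq_range (E : Finset V) (e : V) :
    evenArr E e = Set.range fun g => hyp (resNormal e (evenPart E e) g) := by
  simp_rw [hyp_resNormal]
  ext W
  simp only [evenArr, evenPart, Set.mem_ofPred_eq, Set.mem_range, Subtype.exists, Finset.mem_filter,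
    Finset.mem_erase, exists_prop]
  constructor
  · rintro ⟨g, h1, h2, h3, h4⟩; exact ⟨g, ⟨⟨h2, h1⟩, h3⟩, h4.symm⟩
  · rintro ⟨g, ⟨⟨h2, h1⟩, h3⟩, h4⟩; exact ⟨g, h1, h2, h3, h4.symm⟩

/-- A hyperplane of `H_e` contained in another equals it, so the vectors counted are those with the
same trace on `H_e` as `f`, and `e` itself, the `+ 1`. -/
theorem interMult_eq {E : Finset V} (hunit : ∀ e ∈ E, ‖e‖ = 1)
    (hindep : ∀ e ∈ E, ∀ e' ∈ E, e ≠ e' → LinearIndependent ℝ ![e, e']) {e f : V} (he : e ∈ E)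
    (hf : f ∈ E.erase e) :
    interMult E (hyp e ⊓ hyp f) = Finset.card {g ∈ E.erase e |
      (hyp g).comap (hyp e).subtype = (hyp f).comap (hyp e).subtype} + 1 := by
  have hiff : ∀ g ∈ E.erase e, hyp e ⊓ hyp f ≤ hyp g ↔
      (hyp g).comap (hyp e).subtype = (hyp f).comap (hyp e).subtype := by
    intro g hg
    rw [← hyp_resNormal (F := E.erase e) ⟨g, hg⟩, ← hyp_resNormal (F := E.erase e) ⟨f, hf⟩]
    have hn := resNormal_ne_zero hunit hindep he (Finset.Subset.refl _) ⟨g, hg⟩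
    constructor
    · intro h
      refine (hyp_eq_of_le hn fun y hy => ?_).symm
      rw [mem_hyp, inner_resNormal] at hy ⊢
      exact mem_hyp.1 (h ⟨y.2, mem_hyp.2 hy⟩)
    · rintro h y ⟨hy1, hy2⟩
      have : (⟨y, hy1⟩ : hyp e) ∈ hyp (resNormal e (E.erase e) ⟨g, hg⟩) := by
        rw [h, mem_hyp, inner_resNormal]
        exact mem_hyp.1 hy2
      rw [mem_hyp, inner_resNormal] at this
      exact mem_hyp.2 this
  rw [interMult, ← Finset.card_insert_of_notMem (a := e) (by simp), ← Set.ncard_coe_finset]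
  congr 1
  ext g
  by_cases hge : g = e
  · subst hge; simp [he]
  · simp only [Set.mem_ofPred_eq, Finset.coe_insert, Finset.coe_filter, Set.mem_insert_iff, hge,
      false_or, Finset.mem_erase, ne_eq, not_false_eq_true, true_and]
    exact and_congr_right fun hg => hiff g (Finset.mem_erase.2 ⟨hge, hg⟩)

/-- Passing from `y₀` to `y` inside `H_e`, the product of the signs of the vectors other than `e`
changes according to the number of separating hyperplanes of the even restricted arrangement. -/
theorem chamberSign_evenArr {E : Finset V} (hunit : ∀ e ∈ E, ‖e‖ = 1)
    (hindep : ∀ e ∈ E, ∀ e' ∈ E, e ≠ e' → LinearIndependent ℝ ![e, e']) {e : V} (he : e ∈ E)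
    {Z₀ Z : Set (hyp e)} (hZ₀ : Z₀ ∈ chambers (evenArr E e)) (hZ : Z ∈ chambers (evenArr E e))
    {y₀ y : hyp e} (hy₀Z : y₀ ∈ Z₀) (hyZ : y ∈ Z)
    (hy₀ : ∀ g ∈ E, g ≠ e → (inner ℝ g (y₀ : V) : ℝ) ≠ 0)
    (hy : ∀ g ∈ E, g ≠ e → (inner ℝ g (y : V) : ℝ) ≠ 0) :
    chamberSign (evenArr E e) Z₀ Z = offProd E e y₀ * offProd E e y := by
  set W : V → Submodule ℝ (hyp e) := fun g => (hyp g).comap (hyp e).subtype with hW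
  set δ : Submodule ℝ (hyp e) → ℤ := fun H => if Separates H {y₀} {y} then -1 else 1 with hδ
  have hA : evenArr E e = (((evenPart E e).image W : Finset _) : Set (Submodule ℝ (hyp e))) := by
    rw [evenArr_eq_range]
    ext H
    simp [hyp_resNormal, hW]
  have hsep : ∀ g (hg : g ∈ E.erase e), Separates (W g) {y₀} {y} ↔
      SignType.sign (inner ℝ g (y₀ : V) : ℝ) ≠ SignType.sign (inner ℝ g (y : V) : ℝ) := by
    intro g hg
    obtain ⟨hge, hgE⟩ := Finset.mem_erase.1 hg
    have h := hyp_resNormal (e := e) (F := E.erase e) ⟨g, hg⟩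
    rw [hW]
    simp only at h ⊢
    rw [← h]
    refine separates_hyp_iff (sign_ne_zero.2 (hy₀ g hgE hge)) (sign_ne_zero.2 (hy g hgE hge))
      ?_ ⟨y₀, rfl⟩ ?_ ⟨y, rfl⟩
    · rintro x rfl; rw [inner_resNormal]
    · rintro x rfl; rw [inner_resNormal]
  have hprod : offProd E e y₀ * offProd E e y = ∏ g ∈ E.erase e, δ (W g) := by
    rw [offProd, offProd, signProd, signProd, ← Finset.prod_mul_distrib]
    refine Finset.prod_congr rfl fun g hg => ?_
    obtain ⟨hge, hgE⟩ := Finset.mem_erase.1 hg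
    simp only [hδ, hsep g hg]
    rcases lt_or_gt_of_ne (hy₀ g hgE hge) with h | h <;>
      rcases lt_or_gt_of_ne (hy g hgE hge) with h' | h' <;>
      simp [sign_neg, sign_pos, h, h']
  have hδsq : ∀ H, δ H ^ 2 = 1 := by
    intro H; simp only [hδ]; split_ifs <;> norm_num
  have hcard : ∀ f ∈ E.erase e, (Even (interMult E (hyp e ⊓ hyp f)) ↔
      ¬ Even (Finset.card {g ∈ E.erase e | W g = W f})) := by
    intro f hf
    rw [interMult_eq hunit hindep he hf, Nat.even_add_one]
  -- Signs of vectors in `evenPart E e` are constant on `Z₀` and `Z`, so the points may replace the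
  -- chambers. For other vectors this can fail.
  have hsepZ : ∀ g ∈ evenPart E e, Separates (W g) Z₀ Z ↔ Separates (W g) {y₀} {y} := by
    intro g hg
    have hg' := evenPart_subset E e hg
    obtain ⟨hge, hgE⟩ := Finset.mem_erase.1 hg'
    rw [hsep g hg']
    have h := hyp_resNormal (e := e) (F := evenPart E e) ⟨g, hg⟩
    rw [hW]
    simp only at h ⊢
    rw [← h]
    rw [evenArr_eq_range] at hZ₀ hZ
    obtain ⟨z₀, -, rfl⟩ := mem_chambers_iff.1 hZ₀
    obtain ⟨z, -, rfl⟩ := mem_chambers_iff.1 hZ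
    rw [← cell_eq_of_mem hy₀Z, ← cell_eq_of_mem hyZ]
    refine separates_hyp_iff (sign_ne_zero.2 (hy₀ g hgE hge)) (sign_ne_zero.2 (hy g hgE hge))
      ?_ ⟨y₀, rfl⟩ ?_ ⟨y, rfl⟩
    · intro x hx
      exact (mem_cell.1 hx ⟨g, hg⟩).trans (signVec_resNormal _ _)
    · intro x hx
      exact (mem_cell.1 hx ⟨g, hg⟩).trans (signVec_resNormal _ _)
  -- Vectors are grouped by their trace on `H_e`: a class of odd size keeps one factor `δ`, a class
  -- of even size contributes `1`.
  rw [hprod, Finset.prod_comp, hA, chamberSign_eq_prod]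
  have hcongr : ∀ H ∈ (evenPart E e).image W, (if Separates H Z₀ Z then (-1 : ℤ) else 1) =
      δ H ^ Finset.card {g ∈ E.erase e | W g = H} := by
    intro H hH
    obtain ⟨f, hf, rfl⟩ := Finset.mem_image.1 hH
    have hodd := Nat.not_even_iff_odd.1
      ((hcard f (evenPart_subset E e hf)).1 (Finset.mem_filter.1 hf).2)
    obtain ⟨k, hk⟩ := hodd
    rw [hk, pow_add, pow_mul, hδsq, one_pow, one_mul, pow_one]
    simp only [hδ, hsepZ f hf]
  rw [Finset.prod_congr rfl hcongr]
  refine Finset.prod_subset (Finset.image_subset_image (evenPart_subset E e)) fun H hH hH' => ?_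
  obtain ⟨f, hf, rfl⟩ := Finset.mem_image.1 hH
  have heven : Even (Finset.card {g ∈ E.erase e | W g = W f}) := by
    by_contra h
    exact hH' (Finset.mem_image_of_mem W (Finset.mem_filter.2 ⟨hf, (hcard f hf).2 h⟩))
  obtain ⟨k, hk⟩ := heven
  rw [hk, ← two_mul, pow_mul, hδsq, one_pow]

theorem exists_of_mem_restricted_chambers {E : Finset V} {e : V} {U : Set (hyp e)}
    (hU : U ∈ chambers (restrictedArr E e)) :
    ∃ y ∈ U, (∀ g ∈ E, g ≠ e → (inner ℝ g (y : V) : ℝ) ≠ 0) ∧ ∀ z ∈ U, ∀ g ∈ E, g ≠ e →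
      SignType.sign (inner ℝ g (z : V) : ℝ) = SignType.sign (inner ℝ g (y : V) : ℝ) := by
  rw [restrictedArr_eq_range] at hU
  obtain ⟨y, hy, rfl⟩ := mem_chambers_iff.1 hU
  refine ⟨y, mem_cell_self _ _, fun g hg hge => ?_, fun z hz g hg hge => ?_⟩
  · have := hy ⟨g, Finset.mem_erase.2 ⟨hge, hg⟩⟩
    rwa [inner_resNormal] at this
  · have := mem_cell.1 hz ⟨g, Finset.mem_erase.2 ⟨hge, hg⟩⟩
    rwa [signVec_resNormal, signVec_resNormal] at this

/-- The chamber `Z` is open and non-empty, so it has a point off all the traces; the cell of that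
point lies in `Z`, fewer signs being prescribed there. -/
theorem exists_restricted_chamber_subset {E : Finset V} (hunit : ∀ e ∈ E, ‖e‖ = 1)
    (hindep : ∀ e ∈ E, ∀ e' ∈ E, e ≠ e' → LinearIndependent ℝ ![e, e']) {e : V} (he : e ∈ E)
    {Z : Set (hyp e)} (hZ : Z ∈ chambers (evenArr E e)) :
    ∃ U ∈ chambers (restrictedArr E e), U ⊆ Z := by
  let _ : MeasurableSpace (hyp e) := borel _
  have : BorelSpace (hyp e) := ⟨rfl⟩
  rw [evenArr_eq_range] at hZ
  obtain ⟨z, hz, rfl⟩ := mem_chambers_iff.1 hZ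
  obtain ⟨y, hyZ, hy⟩ := exists_mem_inner_ne_zero
    (resNormal_ne_zero hunit hindep he (Finset.Subset.refl _)) (isOpen_cell hz)
    ⟨z, mem_cell_self _ _⟩
  refine ⟨cell (resNormal e (E.erase e)) y, ?_, fun w hw => ?_⟩
  · rw [restrictedArr_eq_range]
    exact mem_chambers_iff.2 ⟨y, hy, rfl⟩
  · rw [← cell_eq_of_mem hyZ, mem_cell]
    intro g
    have := mem_cell.1 hw ⟨g, evenPart_subset E e g.2⟩
    rwa [signVec_resNormal, signVec_resNormal] at this ⊢

/-- No hyperplane separates `Z` from itself, so `chamberSign_evenArr` makes the product of the two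
signs `1`. -/
theorem compSign_eq_of_subset {E : Finset V} (hunit : ∀ e ∈ E, ‖e‖ = 1)
    (hindep : ∀ e ∈ E, ∀ e' ∈ E, e ≠ e' → LinearIndependent ℝ ![e, e'])
    {T₀ : Set V} (hne : T₀.Nonempty) (hpos : ∀ e ∈ E, ∀ x ∈ T₀, 0 < (inner ℝ e x : ℝ)) {e : V}
    (he : e ∈ E) {Z U₁ U₂ : Set (hyp e)} (hZ : Z ∈ chambers (evenArr E e))
    (hU₁ : U₁ ∈ chambers (restrictedArr E e)) (h₁ : U₁ ⊆ Z)
    (hU₂ : U₂ ∈ chambers (restrictedArr E e)) (h₂ : U₂ ⊆ Z) :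
    compSign E T₀ (((↑) : hyp e → V) '' U₁) e = compSign E T₀ (((↑) : hyp e → V) '' U₂) e := by
  have hinj := injOn_hyp hunit hindep
  obtain ⟨y₁, hy₁U, hy₁, hs₁⟩ := exists_of_mem_restricted_chambers hU₁
  obtain ⟨y₂, hy₂U, hy₂, hs₂⟩ := exists_of_mem_restricted_chambers hU₂
  rw [compSign_restricted_chamber hunit hinj hne hpos he hy₁U hy₁ hs₁,
    compSign_restricted_chamber hunit hinj hne hpos he hy₂U hy₂ hs₂]
  have h := chamberSign_evenArr hunit hindep he hZ hZ (h₁ hy₁U) (h₂ hy₂U) hy₁ hy₂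
  rw [chamberSign_self ⟨y₁, h₁ hy₁U⟩] at h
  calc offProd E e y₁ = offProd E e y₁ * (offProd E e y₁ * offProd E e y₂) := by rw [← h, mul_one]
    _ = offProd E e y₂ := by rw [← mul_assoc, offProd_mul_self hy₁, one_mul]

theorem facets_eq_image {E : Finset V} (hunit : ∀ e ∈ E, ‖e‖ = 1)
    (hindep : ∀ e ∈ E, ∀ e' ∈ E, e ≠ e' → LinearIndependent ℝ ![e, e']) {x : V}
    (hx : ∀ g ∈ E, (inner ℝ g x : ℝ) ≠ 0) :
    facets E (cell (fun i : E => (i : V)) x) =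
      wall E x '' ((E.filter fun e => (wall E x e).Nonempty : Finset V) : Set V) := by
  rw [cell_coe_eq]
  ext U
  simp only [Finset.coe_filter, Set.mem_image, Set.mem_ofPred_eq]
  constructor
  · intro hU
    obtain ⟨e, he, rfl⟩ := exists_eq_wall hindep hU
    exact ⟨e, ⟨he, hU.1.1⟩, rfl⟩
  · rintro ⟨e, ⟨he, hne⟩, rfl⟩
    exact wall_mem_facets hunit he hx hne

theorem existsUnique_normal {E : Finset V} (hunit : ∀ e ∈ E, ‖e‖ = 1)
    (hindep : ∀ e ∈ E, ∀ e' ∈ E, e ≠ e' → LinearIndependent ℝ ![e, e'])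
    {T U : Set V} (hT : T ∈ chambers (arr E)) (hU : U ∈ facets E T) :
    ∃! e, e ∈ E ∧ U ⊆ (hyp e : Set V) := by
  rw [arr_eq_range] at hT
  obtain ⟨x, hx, rfl⟩ := mem_chambers_iff.1 hT
  have hx' : ∀ g ∈ E, (inner ℝ g x : ℝ) ≠ 0 := fun g hg => hx ⟨g, hg⟩
  rw [facets_eq_image hunit hindep hx'] at hU
  obtain ⟨e, he, rfl⟩ := hU
  obtain ⟨he, hne⟩ := Finset.mem_filter.1 (Finset.mem_coe.1 he)
  exact ⟨e, ⟨he, wall_subset_hyp E x e⟩, fun g hg => eq_of_wall_subset_hyp hx' hne hg.1 hg.2⟩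

end Restriction

/-! ### The two formulas for translates. -/

section Translates

open Classical

variable {V : Type*} [NormedAddCommGroup V] [InnerProductSpace ℝ V]
  [FiniteDimensional ℝ V] [MeasurableSpace V] [BorelSpace V]

theorem pizza_arr {E : Finset V} (hunit : ∀ e ∈ E, ‖e‖ = 1)
    (hinj : Set.InjOn (hyp : V → Submodule ℝ V) E)
    {T₀ : Set V} (hne : T₀.Nonempty) (hpos : ∀ e ∈ E, ∀ x ∈ T₀, 0 < (inner ℝ e x : ℝ))
    {g : V → ℂ} (hg : Integrable g (vol V)) :
    pizza (arr E) T₀ g = ∫ x, ((signProd E x : ℤ) : ℂ) * g x ∂(vol V) := by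
  rw [arr_eq_range]
  refine pizza_eq_integral (v := fun i : E => (i : V))
    (fun i h => by simpa [h] using hunit i i.2) T₀ hg fun T hT => ?_
  obtain ⟨x, hx, rfl⟩ := mem_chambers_iff.1 hT
  refine ae_of_all _ fun y hy => ?_
  rw [← arr_eq_range, chamberSign_arr hinj hne hpos hy]
  · exact fun g hg => inner_ne_zero_of_mem_cell hx hy ⟨g, hg⟩
  · intro z hz g hg
    rw [← cell_eq_of_mem hy] at hz
    exact mem_cell.1 hz ⟨g, hg⟩

theorem pizza_evenArr {E : Finset V} (hunit : ∀ e ∈ E, ‖e‖ = 1)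
    (hindep : ∀ e ∈ E, ∀ e' ∈ E, e ≠ e' → LinearIndependent ℝ ![e, e']) {e : V} (he : e ∈ E)
    {Z₀ : Set (hyp e)} (hZ₀ : Z₀ ∈ chambers (evenArr E e)) {y₀ : hyp e} (hy₀Z : y₀ ∈ Z₀)
    (hy₀ : ∀ g ∈ E, g ≠ e → (inner ℝ g (y₀ : V) : ℝ) ≠ 0) {g : hyp e → ℂ}
    (hg : Integrable g (vol (hyp e))) :
    pizza (evenArr E e) Z₀ g =
      offProd E e y₀ * ∫ y : hyp e, (offProd E e y : ℂ) * g y ∂(vol (hyp e)) := by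
  have hgen : ∀ᵐ y ∂(vol (hyp e)), ∀ i, (inner ℝ (resNormal e (E.erase e) i) y : ℝ) ≠ 0 :=
    ae_all_iff.2 fun i => ae_inner_ne_zero
      (resNormal_ne_zero hunit hindep he (Finset.Subset.refl _) i)
  have h := pizza_eq_integral (v := resNormal e (evenPart E e))
    (resNormal_ne_zero hunit hindep he (evenPart_subset E e)) Z₀ hg
    (s := fun y => ((offProd E e y₀ * offProd E e y : ℤ) : ℂ)) fun Z hZ => by
      filter_upwards [hgen] with y hy hyZ
      rw [← evenArr_eq_range] at hZ ⊢
      rw [chamberSign_evenArr hunit hindep he hZ₀ hZ hy₀Z hyZ hy₀]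
      intro g hg hge
      have := hy ⟨g, Finset.mem_erase.2 ⟨hge, hg⟩⟩
      rwa [inner_resNormal] at this
  rw [← evenArr_eq_range] at h
  rw [h, ← integral_const_mul]
  simp only [Int.cast_mul, mul_assoc]

theorem ae_integrable_shift {e a : V} (he : ‖e‖ = 1) (ha : (inner ℝ a e : ℝ) ≠ 0)
    {f : V → ℂ} (hf : Integrable f (vol V)) :
    ∀ᵐ t : ℝ, Integrable (fun y : hyp e => shift (t • a) f y) (vol (hyp e)) :=
  (integrable_translate he ha hf).prod_right_ae

/-- The pizza quantity of a translate, in terms of the even restricted arrangements. -/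
theorem pizza_shift_sub {E : Finset V} (hunit : ∀ e ∈ E, ‖e‖ = 1)
    (hindep : ∀ e ∈ E, ∀ e' ∈ E, e ≠ e' → LinearIndependent ℝ ![e, e'])
    {T₀ : Set V} (hne : T₀.Nonempty) (hpos : ∀ e ∈ E, ∀ x ∈ T₀, 0 < (inner ℝ e x : ℝ))
    {f : V → ℂ} (hf : Integrable f (vol V)) (a : V) (Z₀ U₀ : (e : V) → Set (hyp e))
    (hZ₀ : ∀ e ∈ E, Z₀ e ∈ chambers (evenArr E e))
    (hU₀ : ∀ e ∈ E, U₀ e ∈ chambers (restrictedArr E e) ∧ U₀ e ⊆ Z₀ e) :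
    pizza (arr E) T₀ (shift a f) - pizza (arr E) T₀ f =
      2 * ∑ e ∈ E, (compSign E T₀ (((↑) : hyp e → V) '' U₀ e) e : ℂ) *
        ((inner ℝ a e : ℝ) : ℂ) *
          ∫ t in (0 : ℝ)..1, pizza (evenArr E e) (Z₀ e)
            (fun y : hyp e => shift (t • a) f y) := by
  have hinj := injOn_hyp hunit hindep
  rw [pizza_arr hunit hinj hne hpos hf,
    pizza_arr (g := shift a f) hunit hinj hne hpos (hf.comp_sub_right a)]
  simp_rw [signProd_eq_prod]
  rw [integral_shift_sub (fun i : E => (i : V)) (fun i => hunit i i.2)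
    (fun i j hij => hindep i i.2 j j.2 fun h => hij (Subtype.ext h))
    (fun σ => ((∏ i, (σ i : ℤ) : ℤ) : ℂ)) a hf, Finset.mul_sum, ← Finset.sum_coe_sort E]
  refine Finset.sum_congr rfl fun e _ => ?_
  by_cases ha : (inner ℝ a (e : V) : ℝ) = 0
  · simp [ha]
  obtain ⟨hU, hUZ⟩ := hU₀ e e.2
  obtain ⟨y₀, hy₀U, hy₀, hs⟩ := exists_of_mem_restricted_chambers hU
  rw [compSign_restricted_chamber hunit hinj hne hpos e.2 hy₀U hy₀ hs]
  have hpz : ∫ t in (0 : ℝ)..1, pizza (evenArr E e) (Z₀ e)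
        (fun y : hyp (e : V) => shift (t • a) f y) =
      (offProd E e y₀ : ℂ) * ∫ t in (0 : ℝ)..1, ∫ y : hyp (e : V),
        (offProd E e y : ℂ) * shift (t • a) f y ∂(vol (hyp (e : V))) := by
    rw [← intervalIntegral.integral_const_mul]
    refine intervalIntegral.integral_congr_ae ?_
    filter_upwards [ae_integrable_shift (hunit e e.2) ha hf] with t ht _
    exact pizza_evenArr hunit hindep e.2 (hZ₀ e e.2) (hUZ hy₀U) hy₀ ht
  have hjump : ∀ y, jump (fun i : E => (i : V)) (fun σ => ((∏ i, (σ i : ℤ) : ℤ) : ℂ)) e y =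
      2 * (offProd E e y : ℂ) := by
    intro y
    rw [jump, prod_update_signVec, prod_update_signVec]
    push_cast
    simp
    ring
  -- The choice of base chamber enters twice, through `compSign` and through the restricted pizza
  -- quantity, and cancels.
  have hsq : (offProd E e y₀ : ℂ) * offProd E e y₀ = 1 := by
    exact_mod_cast offProd_mul_self hy₀
  simp_rw [hpz, hjump, mul_assoc, integral_const_mul, intervalIntegral.integral_const_mul]
  linear_combination (-2 * ((inner ℝ a (e : V) : ℝ) : ℂ) * ∫ t in (0 : ℝ)..1, ∫ y : hyp (e : V),
        (offProd E e y : ℂ) * shift (t • a) f y ∂(vol (hyp (e : V)))) * hsq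

/-- The integral of a translate over a chamber, in terms of the walls of the chamber. -/
theorem setIntegral_shift_sub {E : Finset V} (hunit : ∀ e ∈ E, ‖e‖ = 1)
    (hindep : ∀ e ∈ E, ∀ e' ∈ E, e ≠ e' → LinearIndependent ℝ ![e, e'])
    {f : V → ℂ} (hf : Integrable f (vol V)) (a : V) {x : V}
    (hx : ∀ i : E, (inner ℝ (i : V) x : ℝ) ≠ 0) :
    (∫ y in cell (fun i : E => (i : V)) x, shift a f y ∂(vol V)) -
        ∫ y in cell (fun i : E => (i : V)) x, f y ∂(vol V) =
      ∑ e ∈ E, ((SignType.sign (inner ℝ e x : ℝ) : ℤ) : ℂ) * ((inner ℝ a e : ℝ) : ℂ) *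
        ∫ t in (0 : ℝ)..1, ∫ y in ((↑) : hyp e → V) ⁻¹' wall E x e, shift (t • a) f y
          ∂(vol (hyp e)) := by
  set v : E → V := fun i => (i : V) with hv
  set Φ : (E → SignType) → ℂ := fun σ => if σ = signVec v x then 1 else 0 with hΦ
  have hset : ∀ g : V → ℂ, ∫ y in cell v x, g y ∂(vol V) = ∫ y, Φ (signVec v y) * g y ∂(vol V) := by
    intro g
    rw [← integral_indicator (isOpen_cell hx).measurableSet]
    refine integral_congr_ae (ae_of_all _ fun y => ?_)
    by_cases hy : y ∈ cell v x
    · rw [Set.indicator_of_mem hy]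
      simp [hΦ, show signVec v y = signVec v x from hy]
    · rw [Set.indicator_of_notMem hy]
      simp [hΦ, show ¬ signVec v y = signVec v x from hy]
  rw [hset, hset, integral_shift_sub v (fun i => hunit i i.2)
    (fun i j hij => hindep i i.2 j j.2 fun h => hij (Subtype.ext h)) Φ a hf,
    ← Finset.sum_coe_sort E]
  refine Finset.sum_congr rfl fun e _ => ?_
  have hupd : ∀ (y : hyp (e : V)) (s : SignType), Function.update (signVec v y) e s = signVec v x ↔
      (y : V) ∈ wall E x e ∧ s = SignType.sign (inner ℝ (e : V) x : ℝ) := by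
    intro y s
    rw [Function.update_eq_iff]
    constructor
    · rintro ⟨h1, h2⟩
      exact ⟨⟨mem_hyp.1 y.2, fun g hg hge => h2 ⟨g, hg⟩ fun h => hge (congrArg Subtype.val h)⟩, h1⟩
    · rintro ⟨⟨-, h1⟩, h2⟩
      exact ⟨h2, fun i hi => h1 i i.2 fun h => hi (Subtype.ext h)⟩
  -- Off the wall neither value at entry `e` gives the sign vector of `x`; on it exactly one does,
  -- and the sign of `e` at `x` tells which.
  have hjump : ∀ (t : ℝ) (y : hyp (e : V)), jump v Φ e y * shift (t • a) f y =
      ((SignType.sign (inner ℝ (e : V) x : ℝ) : ℤ) : ℂ) *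
        Set.indicator (((↑) : hyp (e : V) → V) ⁻¹' wall E x e)
          (fun y : hyp (e : V) => shift (t • a) f y) y := by
    intro t y
    simp only [jump, hΦ, hupd, Set.indicator, Set.mem_preimage]
    by_cases hy : (y : V) ∈ wall E x e
    · rcases lt_or_gt_of_ne (hx e) with h | h
      · simp [hy, sign_neg h]
      · simp [hy, sign_pos h]
    · simp [hy]
  have hmeas : MeasurableSet (((↑) : hyp (e : V) → V) ⁻¹' wall E x e) := by
    have : ((↑) : hyp (e : V) → V) ⁻¹' wall E x e = ⋂ i ∈ E.erase (e : V),
        ((↑) : hyp (e : V) → V) ⁻¹'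
          {y | SignType.sign (inner ℝ i y : ℝ) = SignType.sign (inner ℝ i x : ℝ)} := by
      ext y
      simp only [wall, Set.mem_preimage, Set.mem_ofPred_eq, mem_hyp.1 y.2, true_and, Set.mem_iInter,
        Finset.mem_erase]
      exact ⟨fun h i hi => h i hi.2 hi.1, fun h g hg hge => h g ⟨hge, hg⟩⟩
    rw [this]
    refine Finset.measurableSet_biInter _ fun i hi => measurable_subtype_coe ?_
    exact (isOpen_sign_eq i (sign_ne_zero.2 (hx ⟨i, (Finset.mem_erase.1 hi).2⟩))).measurableSet
  change ((inner ℝ a (e : V) : ℝ) : ℂ) * ∫ t in (0 : ℝ)..1, ∫ y : hyp (e : V),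
    jump v Φ e y * shift (t • a) f y ∂(vol (hyp (e : V))) = _
  simp_rw [hjump, integral_const_mul, intervalIntegral.integral_const_mul,
    integral_indicator hmeas]
  ring

/-- The integral of a translate over a chamber, in terms of the facets of the chamber. -/
theorem setIntegral_shift_sub_facets {E : Finset V} (hunit : ∀ e ∈ E, ‖e‖ = 1)
    (hindep : ∀ e ∈ E, ∀ e' ∈ E, e ≠ e' → LinearIndependent ℝ ![e, e'])
    {T₀ : Set V} (hne : T₀.Nonempty) (hpos : ∀ e ∈ E, ∀ x ∈ T₀, 0 < (inner ℝ e x : ℝ))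
    {f : V → ℂ} (hf : Integrable f (vol V)) (a : V) {T : Set V} (hT : T ∈ chambers (arr E))
    {eU : Set V → V} (heU : ∀ U ∈ facets E T, eU U ∈ E ∧ U ⊆ (hyp (eU U) : Set V)) :
    (∫ x in T, shift a f x ∂(vol V)) - ∫ x in T, f x ∂(vol V) =
      ∑ᶠ U ∈ facets E T,
        (chamberSign (arr E) T₀ T : ℂ) * (compSign E T₀ U (eU U) : ℂ) *
          ((inner ℝ a (eU U) : ℝ) : ℂ) *
          ∫ t in (0 : ℝ)..1, ∫ y in ((↑) : hyp (eU U) → V) ⁻¹' U, shift (t • a) f y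
            ∂(vol (hyp (eU U))) := by
  have hinj := injOn_hyp hunit hindep
  rw [arr_eq_range] at hT
  obtain ⟨x, hx, rfl⟩ := mem_chambers_iff.1 hT
  have hx' : ∀ g ∈ E, (inner ℝ g x : ℝ) ≠ 0 := fun g hg => hx ⟨g, hg⟩
  rw [setIntegral_shift_sub hunit hindep hf a hx]
  rw [facets_eq_image hunit hindep hx'] at heU ⊢
  -- The normal of a wall is forced, so distinct `e` give distinct facets and the sum may run over
  -- `E`, empty walls adding `0`.
  have hwall : ∀ e ∈ E.filter fun e => (wall E x e).Nonempty, eU (wall E x e) = e := by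
    intro e he
    obtain ⟨h1, h2⟩ := heU _ ⟨e, Finset.mem_coe.2 he, rfl⟩
    exact eq_of_wall_subset_hyp hx' (Finset.mem_filter.1 he).2 h1 h2
  rw [finsum_mem_image fun e he e' he' h => by
    rw [← hwall e he, ← hwall e' he', h], finsum_mem_coe_finset, Finset.sum_filter]
  refine Finset.sum_congr rfl fun e he => ?_
  by_cases hw : (wall E x e).Nonempty
  · rw [if_pos hw, hwall e (Finset.mem_filter.2 ⟨he, hw⟩)]
    congr 2
    obtain ⟨y, hy⟩ := hw
    rw [compSign_eq hunit hinj hne hpos he (fun z hz => hz.1) hy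
      (fun g hg hge => by
        rw [← sign_ne_zero, hy.2 g hg hge]; exact sign_ne_zero.2 (hx' g hg))
      (fun z hz g hg hge => by rw [hz.2 g hg hge, hy.2 g hg hge]),
      chamberSign_arr hinj hne hpos (mem_cell_self _ x) hx'
        (by rw [cell_coe_eq]; exact fun z hz => hz), offProd_congr hy.2, signProd,
      ← Finset.mul_prod_erase _ _ he]
    -- The chamber sign and the facet sign share all factors except that of `e`; their product is
    -- the sign of `e` on the chamber.
    have h := offProd_mul_self (e := e) fun g hg _ => hx' g hg
    rw [offProd, signProd] at h ⊢
    norm_cast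
    rw [mul_assoc, h, mul_one]
  · rw [if_neg hw, Set.not_nonempty_iff_eq_empty.1 hw]
    simp

end Translates

end Pizza

theorem theorem3p3 {V : Type*} [NormedAddCommGroup V] [InnerProductSpace ℝ V]
    [FiniteDimensional ℝ V] [MeasurableSpace V] [BorelSpace V]
    (E : Finset V)
    (hunit : ∀ e ∈ E, ‖e‖ = 1)
    (hindep : ∀ e ∈ E, ∀ e' ∈ E, e ≠ e' → LinearIndependent ℝ ![e, e'])
    (T₀ : Set V) (hT₀ : T₀ ∈ Pizza.chambers (Pizza.arr E))
    (hpos : ∀ e ∈ E, ∀ x ∈ T₀, 0 < (inner ℝ e x : ℝ))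
    (f : V → ℂ) (hf : Integrable f (Pizza.vol V)) (a : V) :
    -- the integrals with a nonzero coefficient `(a, e)` below all exist
    (∀ e ∈ E, (inner ℝ a e : ℝ) ≠ 0 →
      Integrable (fun p : ℝ × Pizza.hyp e => Pizza.shift (p.1 • a) f p.2)
        (((volume : Measure ℝ).restrict (Set.Icc 0 1)).prod (Pizza.vol (Pizza.hyp e)))) ∧
    -- (i): every facet has a unique normal `e_U` in `E`, and the formula for one chamber
    (∀ T ∈ Pizza.chambers (Pizza.arr E),
      (∀ U ∈ Pizza.facets E T, ∃! e, e ∈ E ∧ U ⊆ (Pizza.hyp e : Set V)) ∧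
      ∀ eU : Set V → V,
        (∀ U ∈ Pizza.facets E T, eU U ∈ E ∧ U ⊆ (Pizza.hyp (eU U) : Set V)) →
        (∫ x in T, Pizza.shift a f x ∂(Pizza.vol V)) - ∫ x in T, f x ∂(Pizza.vol V) =
          ∑ᶠ U ∈ Pizza.facets E T,
            (Pizza.chamberSign (Pizza.arr E) T₀ T : ℂ) * (Pizza.compSign E T₀ U (eU U) : ℂ) *
              ((inner ℝ a (eU U) : ℝ) : ℂ) *
              ∫ t in (0 : ℝ)..1,
                ∫ y in ((↑) : Pizza.hyp (eU U) → V) ⁻¹' U, Pizza.shift (t • a) f y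
                  ∂(Pizza.vol (Pizza.hyp (eU U)))) ∧
    -- the sign `(-1)^{Z ∘ e}` is well defined: some chamber `U` of the restricted arrangement
    -- lies in `Z`, and `(-1)^{U ∘ e}` is the same for all of them
    (∀ e ∈ E, ∀ Z ∈ Pizza.chambers (Pizza.evenArr E e),
      (∃ U ∈ Pizza.chambers (Pizza.restrictedArr E e), U ⊆ Z) ∧
      ∀ U₁ ∈ Pizza.chambers (Pizza.restrictedArr E e), U₁ ⊆ Z →
      ∀ U₂ ∈ Pizza.chambers (Pizza.restrictedArr E e), U₂ ⊆ Z →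
        Pizza.compSign E T₀ (((↑) : Pizza.hyp e → V) '' U₁) e =
          Pizza.compSign E T₀ (((↑) : Pizza.hyp e → V) '' U₂) e) ∧
    -- (ii): `Z₀ e` is any base chamber of the even restricted arrangement, and
    -- `(-1)^{Z₀(e) ∘ e}` is computed from any chamber `U₀ e ⊆ Z₀ e` of the restricted arrangement
    (∀ Z₀ U₀ : (e : V) → Set (Pizza.hyp e),
      (∀ e ∈ E, Z₀ e ∈ Pizza.chambers (Pizza.evenArr E e)) →
      (∀ e ∈ E, U₀ e ∈ Pizza.chambers (Pizza.restrictedArr E e) ∧ U₀ e ⊆ Z₀ e) →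
      Pizza.pizza (Pizza.arr E) T₀ (Pizza.shift a f) - Pizza.pizza (Pizza.arr E) T₀ f =
        2 * ∑ e ∈ E,
          (Pizza.compSign E T₀ (((↑) : Pizza.hyp e → V) '' U₀ e) e : ℂ) *
            ((inner ℝ a e : ℝ) : ℂ) *
            ∫ t in (0 : ℝ)..1,
              Pizza.pizza (Pizza.evenArr E e) (Z₀ e)
                (fun y : Pizza.hyp e => Pizza.shift (t • a) f y)) := by
  obtain ⟨x₀, hx₀, rfl⟩ := id hT₀
  have hne := (connectedComponentIn_nonempty_iff.2 hx₀)
  refine ⟨fun e he ha => ?_, fun T hT => ⟨fun U hU => ?_, fun eU heU => ?_⟩, fun e he Z hZ =>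
    ⟨?_, fun U₁ h₁ h₁Z U₂ h₂ h₂Z => ?_⟩, fun Z₀ U₀ hZ₀ hU₀ => ?_⟩
  · refine (Pizza.integrable_translate (hunit e he) ha hf).mono_measure ?_
    exact Measure.prod_mono Measure.restrict_le_self le_rfl
  · exact Pizza.existsUnique_normal hunit hindep hT hU
  · exact Pizza.setIntegral_shift_sub_facets hunit hindep hne hpos hf a hT heU
  · exact Pizza.exists_restricted_chamber_subset hunit hindep he hZ
  · exact Pizza.compSign_eq_of_subset hunit hindep hne hpos he hZ h₁ h₁Z h₂ h₂Z
  · exact Pizza.pizza_shift_sub hunit hindep hne hpos hf a Z₀ U₀ hZ₀ hU₀
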